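/- Let $X$ be a complex manifold. A holomorphic line bundle with connection on $X$ is a pair $(L,\nabla)$ of a holomorphic line bundle $L$ (with sheaf of holomorphic sections $\mathcal L$) and a $\mathbb C$-linear map of sheaves $\nabla:\mathcal L\to\Omega^1_X\otimes\mathcal L$ with $\nabla(fs)=df\otimes s+f\,\nabla s$ for local holomorphic functions $f$ and sections $s$. Define $\nabla^2:\Omega^1_X\otimes\mathcal L\to\Omega^2_X\otimes\mathcal L$ by $\nabla^2(\eta\otimes s)=d\eta\otimes s-\eta\wedge\nabla s$. The connection is integrable if $\nabla^2\circ\nabla=0$. A holomorphic $2$-form $R\in H^0(X,\Omega^2_X)$ is the curvature of $(L,\nabla)$ if $\nabla^2(\nabla s)=R\otimes s$ for all local holomorphic sections $s$. Let $\mathrm{Pic}^{an}_c(X)$ be the group of isomorphism classes of holomorphic line bundles with connection; an isomorphism $(L,\nabla)\to(L',\nabla')$ is an isomorphism of holomorphic line bundles compatible with the connections. The group law is the tensor product $(L_1,\nabla_1)\otimes(L_2,\nabla_2)=(L_1\otimes L_2,\nabla)$ with $\nabla(s_1\otimes s_2)=\nabla_1 s_1\otimes s_2+s_1\otimes\nabla_2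 s_2$, and the neutral element is the class of $(\mathcal O_X,d)$. Let $\mathrm{Pic}^{an}_{ci}(X)$ be the group, with the same group law, of isomorphism classes of holomorphic line bundles with integrable connection. Then every holomorphic line bundle with connection has exactly one curvature $R_\nabla\in H^0(X,\Omega^2_X)$, the map $[(L,\nabla)]\mapsto R_\nabla$ is a well-defined homomorphism of groups $\mathrm{Pic}^{an}_c(X)\to H^0(X,\Omega^2_X)$, and together with the map $\mathrm{Pic}^{an}_{ci}(X)\to \mathrm{Pic}^{an}_c(X)$, $[(L,\nabla)]\mapsto[(L,\nabla)]$, it gives an exact sequence of abelian groups $$0\longrightarrow \mathrm{Pic}^{an}_{ci}(X)\longrightarrow \mathrm{Pic}^{an}_{c}(X)\longrightarrow H^0(X,\Omega^2_X).$$ -/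

import Mathlib

set_option linter.unusedSectionVars false

open scoped Manifold ContDiff

noncomputable section

namespace HolPic

open Bundle Set Filter
open scoped Topology

universe u v

variable {V : Type u} [NormedAddCommGroup V] [NormedSpace ℂ V]
  {X : Type v} [TopologicalSpace X] [ChartedSpace V X]

/-! ### Holomorphic differential forms -/

variable (V X) in
/-- Differential `p`-forms on `X` (of type `(p, 0)`, no regularity imposed). -/
abbrev Form (p : ℕ) : Type (max u v) :=
  ∀ x : X, TangentSpace 𝓘(ℂ, V) x [⋀^Fin p]→L[ℂ] ℂ

/-- The derivative at `x` of the preferred chart at `i`. -/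
def chartD (i x : X) : TangentSpace 𝓘(ℂ, V) x →L[ℂ] V :=
  mfderiv 𝓘(ℂ, V) 𝓘(ℂ, V) (extChartAt 𝓘(ℂ, V) i) x

/-- The derivative at `z` of the inverse of the preferred chart at `i`. -/
def chartSymmD (i : X) (z : V) :
    V →L[ℂ] TangentSpace 𝓘(ℂ, V) ((extChartAt 𝓘(ℂ, V) i).symm z) :=
  mfderiv 𝓘(ℂ, V) 𝓘(ℂ, V) (extChartAt 𝓘(ℂ, V) i).symm z

/-- The expression of a form in the preferred chart at `i`, that is, its pull-back along the
inverse of this chart. -/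
def chartForm {p : ℕ} (η : Form V X p) (i : X) : V → V [⋀^Fin p]→L[ℂ] ℂ := fun z =>
  (η ((extChartAt 𝓘(ℂ, V) i).symm z)).compContinuousLinearMap (chartSymmD i z)

/-- A form is holomorphic near `x` if its expression in the chart at `x` is. -/
def HolFormAt {p : ℕ} (η : Form V X p) (x : X) : Prop :=
  ContDiffAt ℂ ω (chartForm η x) (extChartAt 𝓘(ℂ, V) x x)

/-- The exterior derivative. -/
def extD {p : ℕ} (η : Form V X p) : Form V X (p + 1) := fun x =>
  (extDeriv (chartForm η x) (extChartAt 𝓘(ℂ, V) x x)).compContinuousLinearMap (chartD x x)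

/-- A field of cotangent vectors, regarded as a `1`-form. -/
def oneForm (α : ∀ x : X, TangentSpace 𝓘(ℂ, V) x →L[ℂ] ℂ) : Form V X 1 := fun x =>
  ContinuousAlternatingMap.ofSubsingleton ℂ (TangentSpace 𝓘(ℂ, V) x) ℂ (0 : Fin 1) (α x)

theorem chartForm_add {p : ℕ} (η θ : Form V X p) (i : X) :
    chartForm (η + θ) i = fun z => chartForm η i z + chartForm θ i z := by
  ext z v; rfl

theorem chartForm_smul {p : ℕ} (c : ℂ) (η : Form V X p) (i : X) :
    chartForm (c • η) i = fun z => c • chartForm η i z := by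
  ext z v; rfl

variable (V X) in
/-- The space `H⁰(X, Ω^p)` of holomorphic `p`-forms on `X`. -/
def HolForm (p : ℕ) : Submodule ℂ (Form V X p) where
  carrier := {η | ∀ x, HolFormAt η x}
  add_mem' {η θ} hη hθ x := by
    have := (hη x).add (hθ x)
    rwa [← chartForm_add] at this
  zero_mem' x := by
    have : chartForm (0 : Form V X p) x = fun _ => 0 := by ext z v; rfl
    unfold HolFormAt
    rw [this]
    exact contDiffAt_const
  smul_mem' c η hη x := by
    have := (hη x).const_smul c
    rwa [← chartForm_smul] at this

variable (V X) in
/-- A holomorphic line bundle on the complex manifold `X` with model space `V`: a topological line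
bundle with an atlas of local trivializations whose transition functions are holomorphic. The
fibres are in the lowest universe; this is no restriction, every line bundle is isomorphic to one
whose fibres are copies of `ℂ`. -/
structure HolLineBundle where
  /-- the fibres -/
  fiber : X → Type
  [addCommGroup : ∀ x, AddCommGroup (fiber x)]
  [module : ∀ x, Module ℂ (fiber x)]
  [fiberTop : ∀ x, TopologicalSpace (fiber x)]
  [fiberTopAdd : ∀ x, IsTopologicalAddGroup (fiber x)]
  [fiberTopSmul : ∀ x, ContinuousSMul ℂ (fiber x)]
  [totalTop : TopologicalSpace (TotalSpace ℂ fiber)]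
  [fiberBundle : FiberBundle ℂ fiber]
  [vectorBundle : VectorBundle ℂ ℂ fiber]
  [holomorphic : ContMDiffVectorBundle ω ℂ fiber 𝓘(ℂ, V)]

attribute [instance] HolLineBundle.addCommGroup HolLineBundle.module HolLineBundle.fiberTop
  HolLineBundle.fiberTopAdd HolLineBundle.fiberTopSmul HolLineBundle.totalTop
  HolLineBundle.fiberBundle HolLineBundle.vectorBundle HolLineBundle.holomorphic

namespace HolLineBundle

/-- The section `s` is holomorphic in a neighbourhood of `x`. Local sections are represented by
arbitrary (set-theoretic) extensions to the whole of `X`. -/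
def HolAt (L : HolLineBundle V X) (s : ∀ x, L.fiber x) (x : X) : Prop :=
  ContMDiffAt 𝓘(ℂ, V) (𝓘(ℂ, V).prod 𝓘(ℂ, ℂ)) ω (fun y => TotalSpace.mk' ℂ y (s y)) x

end HolLineBundle

/-! ### coordinates -/

namespace HolLineBundle

variable (L : HolLineBundle V X)

/-- The domain of the preferred trivialization at `i`. -/
def dom (i : X) : Set X := (trivializationAt ℂ L.fiber i).baseSet

/-- The fibre coordinate of the preferred trivialization at `i`. -/
def coord (i x : X) : L.fiber x →L[ℂ] ℂ :=
  (trivializationAt ℂ L.fiber i).continuousLinearMapAt ℂ x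

/-- The local frame given by the preferred trivialization at `i`. -/
def frame (i x : X) : L.fiber x := (trivializationAt ℂ L.fiber i).symmL ℂ x 1

theorem isOpen_dom (i : X) : IsOpen (L.dom i) := (trivializationAt ℂ L.fiber i).open_baseSet

theorem mem_dom (i : X) : i ∈ L.dom i := FiberBundle.mem_baseSet_trivializationAt' i

theorem dom_mem_nhds {i x : X} (hx : x ∈ L.dom i) : L.dom i ∈ 𝓝 x := (L.isOpen_dom i).mem_nhds hx

variable {L}

theorem coord_frame {i x : X} (hx : x ∈ L.dom i) : L.coord i x (L.frame i x) = 1 :=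
  (trivializationAt ℂ L.fiber i).continuousLinearMapAt_symmL hx 1

theorem coord_smul_frame {i x : X} (hx : x ∈ L.dom i) (v : L.fiber x) :
    L.coord i x v • L.frame i x = v := by
  have := (trivializationAt ℂ L.fiber i).symmL_continuousLinearMapAt (R := ℂ) hx v
  conv_rhs => rw [← this]
  rw [coord, frame, ← map_smul, smul_eq_mul, mul_one]

theorem eq_of_coord {i x : X} (hx : x ∈ L.dom i) {v w : L.fiber x}
    (h : L.coord i x v = L.coord i x w) : v = w := by
  rw [← coord_smul_frame hx v, h, coord_smul_frame hx w]

theorem frame_ne_zero {i x : X} (hx : x ∈ L.dom i) : L.frame i x ≠ 0 := by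
  intro h
  have := coord_frame hx
  simp [h] at this

theorem coord_apply {i x : X} (hx : x ∈ L.dom i) (v : L.fiber x) :
    L.coord i x v = (trivializationAt ℂ L.fiber i ⟨x, v⟩).2 := by
  simp only [coord, Trivialization.continuousLinearMapAt_apply]
  exact (Trivialization.linearMapAt_apply _ v).trans (if_pos hx)

theorem holAt_iff {i x : X} (hx : x ∈ L.dom i) {s : ∀ x, L.fiber x} :
    L.HolAt s x ↔ ContMDiffAt 𝓘(ℂ, V) 𝓘(ℂ, ℂ) ω (fun y => L.coord i y (s y)) x := by
  unfold HolAt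
  rw [(trivializationAt ℂ L.fiber i).contMDiffAt_section_iff hx]
  refine Filter.EventuallyEq.contMDiffAt_iff ?_
  filter_upwards [L.dom_mem_nhds hx] with y hy
  rw [coord_apply hy]

/-- (complex) differentiability of a section at a point -/
def DiffAt (L : HolLineBundle V X) (s : ∀ x, L.fiber x) (x : X) : Prop :=
  MDifferentiableAt 𝓘(ℂ, V) (𝓘(ℂ, V).prod 𝓘(ℂ, ℂ)) (fun y => TotalSpace.mk' ℂ y (s y)) x

theorem HolAt.diffAt {s : ∀ x, L.fiber x} {x : X} (h : L.HolAt s x) : L.DiffAt s x :=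
  ContMDiffAt.mdifferentiableAt h (by simp)

theorem diffAt_iff {x : X} {s : ∀ x, L.fiber x} :
    L.DiffAt s x ↔ MDifferentiableAt 𝓘(ℂ, V) 𝓘(ℂ, ℂ) (fun y => L.coord x y (s y)) x := by
  unfold DiffAt
  rw [mdifferentiableAt_section]
  refine Filter.EventuallyEq.mdifferentiableAt_iff ?_
  filter_upwards [L.dom_mem_nhds (L.mem_dom x)] with y hy
  rw [coord_apply hy]

theorem holAt_frame {i x : X} (hx : x ∈ L.dom i) : L.HolAt (L.frame i) x := by
  rw [holAt_iff hx]
  refine (contMDiffAt_const (c := (1 : ℂ))).congr_of_eventuallyEq ?_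
  filter_upwards [L.dom_mem_nhds hx] with y hy
  exact coord_frame hy

theorem HolAt.congr {s t : ∀ x, L.fiber x} {x : X} (h : L.HolAt s x)
    (e : ∀ᶠ y in 𝓝 x, t y = s y) : L.HolAt t x := by
  refine ContMDiffAt.congr_of_eventuallyEq h ?_
  filter_upwards [e] with y hy
  rw [hy]

theorem HolAt.smul {s : ∀ x, L.fiber x} {x : X} (h : L.HolAt s x) {f : X → ℂ}
    (hf : ContMDiffAt 𝓘(ℂ, V) 𝓘(ℂ, ℂ) ω f x) : L.HolAt (fun y => f y • s y) x := by
  rw [holAt_iff (L.mem_dom x)] at h ⊢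
  simp only [map_smul, smul_eq_mul]
  exact ContMDiffAt.mul hf h

/-- The coefficient of a section with respect to a holomorphic local frame. -/
theorem exists_coeff {e s : ∀ x, L.fiber x} {x : X} (he : L.HolAt e x) (he0 : e x ≠ 0)
    (hs : L.HolAt s x) : ∃ f : X → ℂ, ContMDiffAt 𝓘(ℂ, V) 𝓘(ℂ, ℂ) ω f x ∧
      ∀ᶠ y in 𝓝 x, s y = f y • e y := by
  have he' := (holAt_iff (L.mem_dom x)).1 he
  have hs' := (holAt_iff (L.mem_dom x)).1 hs
  have h0 : L.coord x x (e x) ≠ 0 := fun h =>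
    he0 (eq_of_coord (L.mem_dom x) (by rw [h, map_zero]))
  refine ⟨fun y => L.coord x y (s y) / L.coord x y (e y), hs'.div₀ he' h0, ?_⟩
  filter_upwards [L.dom_mem_nhds (L.mem_dom x), he'.continuousAt.eventually_ne h0] with y hy hy0
  refine eq_of_coord hy ?_
  rw [map_smul, smul_eq_mul, div_mul_cancel₀ _ hy0]

end HolLineBundle

variable [IsManifold 𝓘(ℂ, V) ω X]

variable (V X) in
/-- A holomorphic line bundle with a holomorphic connection `∇`. The covariant derivative assigns
to a section `s` and a point `x` a linear map `∇ s x` from the tangent space at `x` to the fibre at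
`x`; at points where the sections are complex differentiable it is additive and satisfies the
Leibniz rule `∇ (f s) = df ⊗ s + f ∇ s` (hence it is local and `ℂ`-linear), and it sends
holomorphic sections over an open set `U` to holomorphic sections over `U` of `Ω¹ ⊗ L`. -/
structure ConnLineBundle extends HolLineBundle V X where
  /-- the connection `∇` -/
  conn : CovariantDerivative 𝓘(ℂ, V) ℂ fiber
  /-- `∇` maps holomorphic sections over open sets to holomorphic sections -/
  hol_conn : ∀ U : Set X, IsOpen U → ContMDiffCovariantDerivativeOn ℂ ω conn U

namespace ConnLineBundle

/-- The value at the tangent vectors `v`, `w` of `∇² (η ⊗ t) = dη ⊗ t - η ∧ ∇ t`, where `η` is a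
`1`-form and `t` a section. -/
def nablaTwo (A : ConnLineBundle V X) (η : ∀ x : X, TangentSpace 𝓘(ℂ, V) x →L[ℂ] ℂ)
    (t : ∀ x, A.fiber x) (x : X) (v w : TangentSpace 𝓘(ℂ, V) x) : A.fiber x :=
  extD (oneForm η) x ![v, w] • t x - (η x v • A.conn t x w - η x w • A.conn t x v)

/-- `R` is the curvature of the connection: `∇² (∇ s) = R ⊗ s` for all local holomorphic sections
`s`. As the bundle has rank one, `∇ s` is locally of the form `η ⊗ t`, where `η` is a holomorphic
`1`-form and `t` a holomorphic section; the equation is required for all such `η` and `t`. -/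
def IsCurvature (A : ConnLineBundle V X) (R : Form V X 2) : Prop :=
  ∀ (x : X) (s t : ∀ x, A.fiber x) (η : ∀ x : X, TangentSpace 𝓘(ℂ, V) x →L[ℂ] ℂ),
    A.HolAt s x → A.HolAt t x → HolFormAt (oneForm η) x →
    (∀ᶠ y in 𝓝 x, A.conn s y = (η y).smulRight (t y)) →
    ∀ v w, A.nablaTwo η t x v w = R x ![v, w] • s x

/-- An isomorphism of line bundles with connection: a family of linear isomorphisms of the fibres
that identifies the local holomorphic sections and is compatible with the connections. -/
structure Iso (A B : ConnLineBundle V X) where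
  toEquiv : ∀ x, A.fiber x ≃ₗ[ℂ] B.fiber x
  hol_iff : ∀ (s : ∀ x, A.fiber x) (x : X),
    B.HolAt (fun y => toEquiv y (s y)) x ↔ A.HolAt s x
  conn_apply : ∀ (s : ∀ x, A.fiber x) (x : X), A.HolAt s x →
    ∀ v, B.conn (fun y => toEquiv y (s y)) x v = toEquiv x (A.conn s x v)

end ConnLineBundle

theorem oneForm_chart (β : ∀ x : X, TangentSpace 𝓘(ℂ, V) x →L[ℂ] ℂ) (i : X) (z : V) :
    chartForm (oneForm β) i z = ContinuousAlternatingMap.ofSubsingletonLIE (𝕜 := ℂ) (E := V) (F := ℂ) (0 : Fin 1)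
      ((β ((extChartAt 𝓘(ℂ, V) i).symm z)).comp (chartSymmD i z)) := by
  ext v; rfl

theorem holFormAt_oneForm (β : ∀ x : X, TangentSpace 𝓘(ℂ, V) x →L[ℂ] ℂ) (x : X) :
    HolFormAt (oneForm β) x ↔ ContDiffAt ℂ ω (fun z =>
      (β ((extChartAt 𝓘(ℂ, V) x).symm z)).comp (chartSymmD x z)) (extChartAt 𝓘(ℂ, V) x x) := by
  unfold HolFormAt
  rw [funext (oneForm_chart β x)]
  exact ContinuousLinearEquiv.comp_contDiffAt_iff
    (ContinuousAlternatingMap.ofSubsingletonLIE (𝕜 := ℂ) (E := V) (F := ℂ) (0 : Fin 1)).toContinuousLinearEquiv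

theorem holFormAt_oneForm' (β : ∀ x : X, TangentSpace 𝓘(ℂ, V) x →L[ℂ] ℂ) (x : X) :
    HolFormAt (oneForm β) x ↔ ContMDiffAt 𝓘(ℂ, V) 𝓘(ℂ, V →L[ℂ] ℂ) ω (fun y =>
      (β y).comp ((trivializationAt V (TangentSpace 𝓘(ℂ, V)) x).symmL ℂ y)) x := by
  rw [holFormAt_oneForm, contMDiffAt_iff_source]
  rw [← contMDiffAt_iff_contDiffAt]
  simp only [modelWithCornersSelf_coe, range_id, contMDiffWithinAt_univ]
  refine Filter.EventuallyEq.contMDiffAt_iff ?_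
  filter_upwards [(isOpen_extChartAt_target x).mem_nhds (mem_extChartAt_target x)] with z hz
  have hy := (extChartAt 𝓘(ℂ, V) x).map_target hz
  have := TangentBundle.symmL_trivializationAt (I := 𝓘(ℂ, V)) (x₀ := x)
    (x := (extChartAt 𝓘(ℂ, V) x).symm z) (by rwa [extChartAt_source] at hy)
  simp only [Function.comp]
  rw [this]
  have key : ∀ z' : V, z' = z →
      (mfderivWithin 𝓘(ℂ, V) 𝓘(ℂ, V) (extChartAt 𝓘(ℂ, V) x).symm (range 𝓘(ℂ, V)) z' : V →L[ℂ] V)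
        = (mfderiv 𝓘(ℂ, V) 𝓘(ℂ, V) (extChartAt 𝓘(ℂ, V) x).symm z : V →L[ℂ] V) := by
    rintro _ rfl
    rw [modelWithCornersSelf_coe, range_id, mfderivWithin_univ]
  have key' := key _ ((extChartAt 𝓘(ℂ, V) x).right_inv hz)
  refine ContinuousLinearMap.ext fun v => ?_
  exact congrArg (fun T : V →L[ℂ] V => β ((extChartAt 𝓘(ℂ, V) x).symm z) (T v)) key'.symm

theorem hom_iff (L : HolLineBundle V X) {s : ∀ x, L.fiber x} {x : X} (hs : L.HolAt s x)
    (hs0 : s x ≠ 0) (β : ∀ x : X, TangentSpace 𝓘(ℂ, V) x →L[ℂ] ℂ) :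
    ContMDiffAt 𝓘(ℂ, V) (𝓘(ℂ, V).prod 𝓘(ℂ, V →L[ℂ] ℂ)) ω
      (fun y => TotalSpace.mk' (V →L[ℂ] ℂ) (E := fun y => TangentSpace 𝓘(ℂ, V) y →L[ℂ] L.fiber y)
        y ((β y).smulRight (s y))) x ↔ HolFormAt (oneForm β) x := by
  rw [contMDiffAt_hom_bundle, holFormAt_oneForm']
  have hid : ContMDiffAt 𝓘(ℂ, V) 𝓘(ℂ, V) ω (fun y : X => y) x := contMDiffAt_id
  simp only [hid, true_and]
  have h : (fun y => ContinuousLinearMap.inCoordinates V (TangentSpace 𝓘(ℂ, V)) ℂ L.fiber x y x y ((β y).smulRight (s y))) = fun y => L.coord x y (s y) • (β y).comp ((trivializationAt V (TangentSpace 𝓘(ℂ, V)) x).symmL ℂ y) := by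
    ext y v
    simp [ContinuousLinearMap.inCoordinates, HolLineBundle.coord, mul_comm]
  rw [h]
  have hc := (HolLineBundle.holAt_iff (L.mem_dom x)).1 hs
  have h0 : L.coord x x (s x) ≠ 0 := fun h =>
    hs0 (HolLineBundle.eq_of_coord (L.mem_dom x) (by rw [h, map_zero]))
  refine ⟨fun H => ?_, fun H => ContMDiffAt.smul hc H⟩
  refine (ContMDiffAt.smul (hc.inv₀ h0) H).congr_of_eventuallyEq ?_
  filter_upwards [hc.continuousAt.eventually_ne h0] with y hy
  simp [smul_smul, inv_mul_cancel₀ hy]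

/-- The differential of a holomorphic function is a holomorphic `1`-form. -/
theorem holFormAt_d {f : X → ℂ} {x : X} (hf : ContMDiffAt 𝓘(ℂ, V) 𝓘(ℂ, ℂ) ω f x) :
    HolFormAt (oneForm (mvfderiv 𝓘(ℂ, V) f)) x := by
  rw [holFormAt_oneForm']
  have := ContMDiffAt.mfderiv_const hf (m := ω) (by simp)
  refine this.congr_of_eventuallyEq ?_
  filter_upwards with y
  refine ContinuousLinearMap.ext fun v => ?_
  simp [inTangentCoordinates, ContinuousLinearMap.inCoordinates, mvfderiv]
  rfl

namespace ConnLineBundle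

variable {A B : ConnLineBundle V X}

theorem conn_congr {s t : ∀ x, A.fiber x} {x : X} (hs : A.DiffAt s x)
    (h : ∀ᶠ y in 𝓝 x, t y = s y) : A.conn t x = A.conn s x := by
  have ht : A.DiffAt t x := by
    refine MDifferentiableAt.congr_of_eventuallyEq hs ?_
    filter_upwards [h] with y hy
    rw [hy]
  exact (A.conn.isCovariantDerivativeOn (s := univ)).congr_of_eventuallyEq ht hs univ_mem h

theorem conn_smul {s e : ∀ x, A.fiber x} {f : X → ℂ} {x : X} (he : A.DiffAt e x)
    (hf : MDifferentiableAt 𝓘(ℂ, V) 𝓘(ℂ, ℂ) f x) (h : ∀ᶠ y in 𝓝 x, s y = f y • e y) :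
    A.conn s x = f x • A.conn e x + (mvfderiv 𝓘(ℂ, V) f x).smulRight (e x) := by
  have hd : A.DiffAt (f • e) x := MDifferentiableAt.smul_section hf he
  rw [conn_congr hd h]
  exact (A.conn.isCovariantDerivativeOn (s := univ)).leibniz he hf

theorem hol_conn_at {s : ∀ x, A.fiber x} {x : X} (hs : A.HolAt s x) :
    ContMDiffAt 𝓘(ℂ, V) (𝓘(ℂ, V).prod 𝓘(ℂ, V →L[ℂ] ℂ)) ω
      (fun y => TotalSpace.mk' (V →L[ℂ] ℂ) (E := fun y => TangentSpace 𝓘(ℂ, V) y →L[ℂ] A.fiber y)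
        y (A.conn s y)) x := by
  have : ∀ᶠ y in 𝓝 x, A.HolAt s y := by
    have h := (contMDiffAt_iff_contMDiffAt_nhds (by simp)).1
      ((HolLineBundle.holAt_iff (A.mem_dom x)).1 hs)
    filter_upwards [h, A.dom_mem_nhds (A.mem_dom x)] with y hy hyd
    exact (HolLineBundle.holAt_iff hyd).2 hy
  obtain ⟨U, hU, hUo, hxU⟩ := eventually_nhds_iff.1 this
  have := (A.hol_conn U hUo).contMDiff (σ := s) fun y hy => (hU y hy).contMDiffWithinAt
  exact (this x hxU).contMDiffAt (hUo.mem_nhds hxU)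

/-- The connection form of `A` in the preferred trivialization at `i`. -/
def connForm (A : ConnLineBundle V X) (i x : X) : TangentSpace 𝓘(ℂ, V) x →L[ℂ] ℂ :=
  (A.coord i x).comp (A.conn (A.frame i) x)

theorem conn_frame {i x : X} (hx : x ∈ A.dom i) :
    A.conn (A.frame i) x = (A.connForm i x).smulRight (A.frame i x) := by
  ext v
  simp [connForm, HolLineBundle.coord_smul_frame hx]

theorem hol_connForm {i x : X} (hx : x ∈ A.dom i) : HolFormAt (oneForm (A.connForm i)) x := by
  rw [← hom_iff A.toHolLineBundle (HolLineBundle.holAt_frame hx) (HolLineBundle.frame_ne_zero hx)]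
  refine (hol_conn_at (HolLineBundle.holAt_frame hx)).congr_of_eventuallyEq ?_
  filter_upwards [A.dom_mem_nhds hx] with y hy
  rw [conn_frame hy]

end ConnLineBundle

theorem mvfderiv_congr {f g : X → ℂ} {x : X} (h : f =ᶠ[𝓝 x] g) :
    mvfderiv 𝓘(ℂ, V) f x = mvfderiv 𝓘(ℂ, V) g x := by
  refine ContinuousLinearMap.ext fun v => ?_
  have := h.mfderiv_eq (I := 𝓘(ℂ, V)) (I' := 𝓘(ℂ, ℂ))
  exact congrArg (fun T : V →L[ℂ] ℂ => T v) this

theorem HolFormAt.add_smul {α β : ∀ x : X, TangentSpace 𝓘(ℂ, V) x →L[ℂ] ℂ} {f : X → ℂ} {x : X}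
    (hα : HolFormAt (oneForm α) x) (hβ : HolFormAt (oneForm β) x)
    (hf : ContMDiffAt 𝓘(ℂ, V) 𝓘(ℂ, ℂ) ω f x) :
    HolFormAt (oneForm fun y => α y + f y • β y) x := by
  rw [holFormAt_oneForm'] at *
  exact hα.add (hf.smul hβ)

namespace HolLineBundle

variable (L : HolLineBundle V X)

/-- The transition function `g i j`, determined by `frame i = g i j • frame j`. -/
def trans (i j x : X) : ℂ := L.coord j x (L.frame i x)

variable {L}

theorem trans_smul {i j x : X} (hj : x ∈ L.dom j) :
    L.trans i j x • L.frame j x = L.frame i x := coord_smul_frame hj _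

theorem coord_eq {i j x : X} (hi : x ∈ L.dom i) (v : L.fiber x) :
    L.coord j x v = L.coord i x v * L.trans i j x := by
  conv_lhs => rw [← coord_smul_frame hi v]
  rw [map_smul, smul_eq_mul, trans]

theorem trans_hol {i j x : X} (hi : x ∈ L.dom i) (hj : x ∈ L.dom j) :
    ContMDiffAt 𝓘(ℂ, V) 𝓘(ℂ, ℂ) ω (L.trans i j) x :=
  (holAt_iff hj).1 (holAt_frame hi)

theorem diffAt_iff' {i x : X} (hi : x ∈ L.dom i) {s : ∀ x, L.fiber x} :
    L.DiffAt s x ↔ MDifferentiableAt 𝓘(ℂ, V) 𝓘(ℂ, ℂ) (fun y => L.coord i y (s y)) x := by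
  rw [diffAt_iff]
  have h1 : (fun y => L.coord x y (s y)) =ᶠ[𝓝 x] fun y => L.coord i y (s y) * L.trans i x y := by
    filter_upwards [L.dom_mem_nhds hi] with y hy using coord_eq hy _
  have h2 : (fun y => L.coord i y (s y)) =ᶠ[𝓝 x] fun y => L.coord x y (s y) * L.trans x i y := by
    filter_upwards [L.dom_mem_nhds (L.mem_dom x)] with y hy using coord_eq hy _
  constructor <;> intro h
  · exact (MDifferentiableAt.mul h
      ((trans_hol (L.mem_dom x) hi).mdifferentiableAt (by simp))).congr_of_eventuallyEq h2
  · exact (MDifferentiableAt.mul h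
      ((trans_hol hi (L.mem_dom x)).mdifferentiableAt (by simp))).congr_of_eventuallyEq h1

theorem withConn_aux {α : X → ∀ x : X, TangentSpace 𝓘(ℂ, V) x →L[ℂ] ℂ}
    (compat : ∀ i j x, x ∈ L.dom i → x ∈ L.dom j →
      mvfderiv 𝓘(ℂ, V) (L.trans i j) x = L.trans i j x • (α i x - α j x))
    {i x : X} (hx : x ∈ L.dom i) {s : ∀ x, L.fiber x} (hs : L.DiffAt s x) :
    (mvfderiv 𝓘(ℂ, V) (fun y => L.coord x y (s y)) x + L.coord x x (s x) • α x x).smulRight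
      (L.frame x x) =
    (mvfderiv 𝓘(ℂ, V) (fun y => L.coord i y (s y)) x + L.coord i x (s x) • α i x).smulRight
      (L.frame i x) := by
  have h1 : (fun y => L.coord x y (s y)) =ᶠ[𝓝 x]
      (fun y => L.coord i y (s y)) * (L.trans i x) := by
    filter_upwards [L.dom_mem_nhds hx] with y hy using coord_eq hy _
  rw [mvfderiv_congr h1, mvfderiv_mul ((diffAt_iff' hx).1 hs)
    ((trans_hol hx (L.mem_dom x)).mdifferentiableAt (by simp)), compat i x x hx (L.mem_dom x),
    ← trans_smul (i := i) (L.mem_dom x), coord_eq (j := x) hx (s x)]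
  ext v
  simp only [ContinuousLinearMap.smulRight_apply, _root_.add_apply,
    _root_.smul_apply, _root_.sub_apply, smul_eq_mul, smul_smul]
  congr 1
  ring

/-- The connection on a line bundle which is given by the forms `α i` with respect to the
preferred local frames: `∇ (f • frame i) = df ⊗ frame i + f α i ⊗ frame i`. -/
def withConn (L : HolLineBundle V X) (α : X → ∀ x : X, TangentSpace 𝓘(ℂ, V) x →L[ℂ] ℂ)
    (hol : ∀ i, ∀ x ∈ L.dom i, HolFormAt (oneForm (α i)) x)
    (compat : ∀ i j x, x ∈ L.dom i → x ∈ L.dom j →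
      mvfderiv 𝓘(ℂ, V) (L.trans i j) x = L.trans i j x • (α i x - α j x)) :
    ConnLineBundle V X where
  toHolLineBundle := L
  conn :=
    { toFun := fun s x => (mvfderiv 𝓘(ℂ, V) (fun y => L.coord x y (s y)) x +
        L.coord x x (s x) • α x x).smulRight (L.frame x x)
      isCovariantDerivativeOnUniv :=
        { add := by
            intro s t x hs ht _
            have h : (fun y => L.coord x y ((s + t) y)) =
              (fun y => L.coord x y (s y)) + fun y => L.coord x y (t y) := by
              ext y; simp
            rw [h, mvfderiv_add (diffAt_iff.1 hs) (diffAt_iff.1 ht)]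
            ext v
            simp only [Pi.add_apply, map_add, ContinuousLinearMap.smulRight_apply,
              _root_.add_apply, _root_.smul_apply, smul_eq_mul]
            module
          leibniz := by
            intro s f x hs hf _
            have h : (fun y => L.coord x y ((f • s) y)) = f * fun y => L.coord x y (s y) := by
              ext y; simp
            have e : (mvfderiv 𝓘(ℂ, V) f x).smulRight (s x) =
                (mvfderiv 𝓘(ℂ, V) f x).smulRight (L.coord x x (s x) • L.frame x x) := by
              rw [coord_smul_frame (L.mem_dom x)]
            rw [h, mvfderiv_mul hf (diffAt_iff.1 hs), e]
            ext v
            simp only [Pi.smul_apply', map_smul, ContinuousLinearMap.smulRight_apply,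
              _root_.add_apply, _root_.smul_apply, smul_eq_mul]
            module } }
  hol_conn U hU := by
    constructor
    intro s hs x hx
    have hsx : ∀ y ∈ U, L.HolAt s y := fun y hy => (hs y hy).contMDiffAt (hU.mem_nhds hy)
    refine ContMDiffAt.contMDiffWithinAt ?_
    have hf := (holAt_iff (L.mem_dom x)).1 (hsx x hx)
    refine ((hom_iff L (holAt_frame (L.mem_dom x)) (frame_ne_zero (L.mem_dom x)) _).2
      ((holFormAt_d hf).add_smul (hol x x (L.mem_dom x)) hf)).congr_of_eventuallyEq ?_
    filter_upwards [L.dom_mem_nhds (L.mem_dom x), hU.mem_nhds hx] with y hy hyU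
    exact congrArg _ (withConn_aux compat hy (hsx y hyU).diffAt)

/-- Data for gluing a line bundle: an open cover with a preferred member around each point,
and transition functions. -/
structure Transition (V : Type u) [NormedAddCommGroup V] [NormedSpace ℂ V] (X : Type v)
    [TopologicalSpace X] [ChartedSpace V X] where
  U : X → Set X
  isOpen_U : ∀ i, IsOpen (U i)
  mem_U : ∀ i, i ∈ U i
  g : X → X → X → ℂ
  g_self : ∀ i, ∀ x ∈ U i, g i i x = 1
  g_comp : ∀ i j k x, x ∈ U i → x ∈ U j → x ∈ U k → g i j x * g j k x = g i k x
  g_hol : ∀ i j x, x ∈ U i → x ∈ U j → ContMDiffAt 𝓘(ℂ, V) 𝓘(ℂ, ℂ) ω (g i j) x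

namespace Transition

variable (T : Transition V X)

/-- The vector bundle core given by the transition functions. -/
def core : VectorBundleCore ℂ X ℂ X where
  baseSet := T.U
  isOpen_baseSet := T.isOpen_U
  indexAt := id
  mem_baseSet_at := T.mem_U
  coordChange i j x := T.g i j x • ContinuousLinearMap.id ℂ ℂ
  coordChange_self i x hx v := by simp [T.g_self i x hx]
  continuousOn_coordChange i j x hx :=
    ((T.g_hol i j x hx.1 hx.2).continuousAt.smul continuousAt_const).continuousWithinAt
  coordChange_comp i j k x hx v := by
    simp [← T.g_comp i j k x hx.1.1 hx.1.2 hx.2]; ring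

instance : T.core.IsContMDiff 𝓘(ℂ, V) ω where
  contMDiffOn_coordChange i j x hx :=
    ((T.g_hol i j x hx.1 hx.2).smul contMDiffAt_const).contMDiffWithinAt

instance (x : X) : IsTopologicalAddGroup (T.core.Fiber x) :=
  inferInstanceAs (IsTopologicalAddGroup ℂ)

instance (x : X) : ContinuousSMul ℂ (T.core.Fiber x) :=
  inferInstanceAs (ContinuousSMul ℂ ℂ)

/-- The line bundle glued from the transition functions. -/
def bundle : HolLineBundle V X where
  fiber := T.core.Fiber

theorem dom_bundle (i : X) : T.bundle.dom i = T.U i := rfl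

theorem trans_bundle {i j x : X} (hi : x ∈ T.U i) (hj : x ∈ T.U j) :
    T.bundle.trans i j x = T.g i j x := by
  have hx := T.mem_U x
  have h1 := T.core.trivializationAt_continuousLinearMapAt (b₀ := j) (b := x) hj
  have h2 := T.core.trivializationAt_symmL (b₀ := i) (b := x) hi
  have h3 : T.bundle.trans i j x =
      (trivializationAt ℂ T.core.Fiber j).continuousLinearMapAt ℂ x
        ((trivializationAt ℂ T.core.Fiber i).symmL ℂ x 1) := rfl
  rw [h3, h1, h2]
  change T.g x j x • (T.g i x x • (1 : ℂ)) = T.g i j x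
  rw [← T.g_comp i x j x hi hx hj]
  simp [mul_comm]

end Transition

theorem trans_ne_zero {i j x : X} (hi : x ∈ L.dom i) (hj : x ∈ L.dom j) : L.trans i j x ≠ 0 := by
  intro h
  apply frame_ne_zero hi
  rw [← trans_smul hj, h, zero_smul]

/-- The tensor product of two line bundles, glued from the products of the transition functions. -/
def tensor (L M : HolLineBundle V X) : HolLineBundle V X := Transition.bundle
  { U := fun i => L.dom i ∩ M.dom i
    isOpen_U := fun i => (L.isOpen_dom i).inter (M.isOpen_dom i)
    mem_U := fun i => ⟨L.mem_dom i, M.mem_dom i⟩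
    g := fun i j x => L.trans i j x * M.trans i j x
    g_self := fun i x hx => by
      rw [trans, trans, coord_frame hx.1, coord_frame hx.2, mul_one]
    g_comp := fun i j k x _ hj _ => by
      rw [show L.trans i k x = _ from coord_eq hj.1 (L.frame i x),
        show M.trans i k x = _ from coord_eq hj.2 (M.frame i x), ← trans, ← trans]
      ring
    g_hol := fun i j x hi hj => (trans_hol hi.1 hj.1).mul (trans_hol hi.2 hj.2) }

/-- The dual line bundle, glued from the inverse transition functions. -/
def dual (L : HolLineBundle V X) : HolLineBundle V X := Transition.bundle
  { U := L.dom
    isOpen_U := L.isOpen_dom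
    mem_U := L.mem_dom
    g := fun i j x => (L.trans i j x)⁻¹
    g_self := fun i x hx => by rw [trans, coord_frame hx, inv_one]
    g_comp := fun i j k x _ hj _ => by
      rw [show L.trans i k x = _ from coord_eq hj (L.frame i x), ← trans, mul_inv]
    g_hol := fun i j x hi hj => (trans_hol hi hj).inv₀ (trans_ne_zero hi hj) }

theorem mem_tensor {L M : HolLineBundle V X} {i x : X} :
    x ∈ (L.tensor M).dom i ↔ x ∈ L.dom i ∧ x ∈ M.dom i := Iff.rfl

theorem mem_dual {i x : X} : x ∈ L.dual.dom i ↔ x ∈ L.dom i := Iff.rfl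

theorem trans_tensor {L M : HolLineBundle V X} {i j x : X} (hi : x ∈ (L.tensor M).dom i)
    (hj : x ∈ (L.tensor M).dom j) : (L.tensor M).trans i j x = L.trans i j x * M.trans i j x :=
  Transition.trans_bundle _ hi hj

theorem trans_dual {i j x : X} (hi : x ∈ L.dual.dom i) (hj : x ∈ L.dual.dom j) :
    L.dual.trans i j x = (L.trans i j x)⁻¹ :=
  Transition.trans_bundle _ hi hj

/-- The canonical bilinear map from the fibres of two line bundles to the fibre of the tensor
product. -/
def tmul (L M : HolLineBundle V X) (x : X) (v : L.fiber x) (w : M.fiber x) :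
    (L.tensor M).fiber x :=
  (L.coord x x v * M.coord x x w) • (L.tensor M).frame x x

theorem tmul_eq {L M : HolLineBundle V X} {i x : X} (hi : x ∈ (L.tensor M).dom i)
    (v : L.fiber x) (w : M.fiber x) :
    tmul L M x v w = (L.coord i x v * M.coord i x w) • (L.tensor M).frame i x := by
  obtain ⟨h1, h2⟩ := mem_tensor.1 hi
  rw [tmul, coord_eq (j := x) h1 v, coord_eq (j := x) h2 w,
    ← trans_smul (L := L.tensor M) (i := i) ((L.tensor M).mem_dom x),
    trans_tensor hi ((L.tensor M).mem_dom x), smul_smul]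
  congr 1
  ring

/-- The inverse in the fibre of the dual bundle of a nonzero vector. -/
def vinv (L : HolLineBundle V X) (x : X) (v : L.fiber x) : L.dual.fiber x :=
  (L.coord x x v)⁻¹ • L.dual.frame x x

theorem vinv_eq {i x : X} (hi : x ∈ L.dom i) (v : L.fiber x) :
    vinv L x v = (L.coord i x v)⁻¹ • L.dual.frame i x := by
  rw [vinv, coord_eq (j := x) hi v,
    ← trans_smul (L := L.dual) (i := i) (L.dual.mem_dom x),
    trans_dual hi (L.dual.mem_dom x), smul_smul, mul_inv]

end HolLineBundle

namespace ConnLineBundle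

open HolLineBundle

variable {A B : ConnLineBundle V X}

theorem connForm_compat {i j x : X} (hi : x ∈ A.dom i) (hj : x ∈ A.dom j) :
    mvfderiv 𝓘(ℂ, V) (A.trans i j) x = A.trans i j x • (A.connForm i x - A.connForm j x) := by
  have h := conn_smul (A := A) (s := A.frame i) (holAt_frame hj).diffAt
    ((trans_hol hi hj).mdifferentiableAt (by simp)) (by
      filter_upwards [A.dom_mem_nhds hj] with y hy using (trans_smul hy).symm)
  rw [conn_frame hi, conn_frame hj, ← trans_smul (i := i) hj] at h
  ext v
  have hv := congrArg (fun T => A.coord j x (T v)) h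
  simp only [ContinuousLinearMap.smulRight_apply, _root_.add_apply, _root_.smul_apply,
    map_smul, map_add, coord_frame hj, smul_eq_mul, mul_one] at hv
  simp only [_root_.sub_apply, _root_.smul_apply, smul_eq_mul]
  linear_combination -hv

/-- The tensor product of two line bundles with connection. Its connection form is the sum of the
connection forms, that is, `∇ (s ⊗ t) = ∇ s ⊗ t + s ⊗ ∇ t`; this is proved in `conn_tmul` below. -/
def tensor (A B : ConnLineBundle V X) : ConnLineBundle V X :=
  (A.toHolLineBundle.tensor B.toHolLineBundle).withConn (fun i x => A.connForm i x + B.connForm i x)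
    (fun i x hx => by
      obtain ⟨h1, h2⟩ := mem_tensor.1 hx
      simpa using (hol_connForm h1).add_smul (hol_connForm h2) (contMDiffAt_const (c := (1 : ℂ))))
    (fun i j x hi hj => by
      obtain ⟨i1, i2⟩ := mem_tensor.1 hi
      obtain ⟨j1, j2⟩ := mem_tensor.1 hj
      have h : (A.toHolLineBundle.tensor B.toHolLineBundle).trans i j =ᶠ[𝓝 x]
          A.trans i j * B.trans i j := by
        filter_upwards [HolLineBundle.dom_mem_nhds _ hi, HolLineBundle.dom_mem_nhds _ hj]
          with y h1 h2 using trans_tensor h1 h2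
      rw [mvfderiv_congr h, trans_tensor hi hj, mvfderiv_mul
        ((trans_hol i1 j1).mdifferentiableAt (by simp))
        ((trans_hol i2 j2).mdifferentiableAt (by simp)),
        connForm_compat i1 j1, connForm_compat i2 j2]
      module)

/-- The dual of a line bundle with connection, with the dual connection. Its connection form is
the negative of the connection form. -/
def dual (A : ConnLineBundle V X) : ConnLineBundle V X :=
  A.toHolLineBundle.dual.withConn (fun i x => - A.connForm i x)
    (fun i x hx => by
      have h := hol_connForm (A := A) (mem_dual.1 hx)
      rw [holFormAt_oneForm'] at h ⊢
      exact h.neg)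
    (fun i j x hi hj => by
      have h : (A.trans i j) * A.toHolLineBundle.dual.trans i j =ᶠ[𝓝 x] fun _ => 1 := by
        filter_upwards [HolLineBundle.dom_mem_nhds _ hi, HolLineBundle.dom_mem_nhds _ hj]
          with y h1 h2
        simp only [Pi.mul_apply]
        rw [trans_dual h1 h2, mul_inv_cancel₀ (trans_ne_zero (mem_dual.1 h1) (mem_dual.1 h2))]
      have h' := mvfderiv_congr (V := V) h
      rw [mvfderiv_const, mvfderiv_mul
        ((trans_hol (mem_dual.1 hi) (mem_dual.1 hj)).mdifferentiableAt (by simp))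
        ((trans_hol hi hj).mdifferentiableAt (by simp)),
        connForm_compat (mem_dual.1 hi) (mem_dual.1 hj),
        trans_dual hi hj] at h'
      have h0 := trans_ne_zero (L := A.toHolLineBundle) (mem_dual.1 hi) (mem_dual.1 hj)
      rw [trans_dual hi hj]
      ext v
      have hv := congrArg (fun T => T v) h'
      simp only [_root_.add_apply, _root_.smul_apply, _root_.sub_apply, _root_.neg_apply,
        _root_.zero_apply, smul_eq_mul] at hv ⊢
      refine mul_left_cancel₀ h0 ?_
      rw [inv_mul_cancel_left₀ h0] at hv
      rw [mul_inv_cancel_left₀ h0]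
      linear_combination hv)

end ConnLineBundle

theorem coord_trivial (i x : X) (v : Bundle.Trivial X ℂ x) :
    (trivializationAt ℂ (Bundle.Trivial X ℂ) i).continuousLinearMapAt ℂ x v = v := by
  change (Bundle.Trivial.trivialization X ℂ).continuousLinearMapAt ℂ x v = v
  rw [Bundle.Trivial.continuousLinearMapAt_trivialization]
  rfl

variable (V X) in
/-- The trivial line bundle `𝒪`. -/
def HolLineBundle.trivial : HolLineBundle V X where
  fiber := Bundle.Trivial X ℂ
  fiberTopAdd _ := inferInstanceAs (IsTopologicalAddGroup ℂ)
  fiberTopSmul _ := inferInstanceAs (ContinuousSMul ℂ ℂ)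

theorem HolLineBundle.trivial_holAt {f : X → ℂ} {x : X} :
    (HolLineBundle.trivial V X).HolAt f x ↔ ContMDiffAt 𝓘(ℂ, V) 𝓘(ℂ, ℂ) ω f x := by
  refine (HolLineBundle.holAt_iff ((HolLineBundle.trivial V X).mem_dom x)).trans ?_
  refine Filter.EventuallyEq.contMDiffAt_iff (Filter.Eventually.of_forall fun y => ?_)
  exact coord_trivial x y (f y)

theorem HolLineBundle.trivial_diffAt {f : X → ℂ} {x : X} :
    (HolLineBundle.trivial V X).DiffAt f x ↔ MDifferentiableAt 𝓘(ℂ, V) 𝓘(ℂ, ℂ) f x := by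
  refine HolLineBundle.diffAt_iff.trans ?_
  refine Filter.EventuallyEq.mdifferentiableAt_iff (Filter.Eventually.of_forall fun y => ?_)
  exact coord_trivial x y (f y)

namespace ConnLineBundle

open HolLineBundle

variable {A B C : ConnLineBundle V X}

variable (V X) in
/-- The trivial line bundle with the connection `d`. -/
def trivial : ConnLineBundle V X where
  toHolLineBundle := HolLineBundle.trivial V X
  conn :=
    { toFun := fun (f : X → ℂ) => mvfderiv 𝓘(ℂ, V) f
      isCovariantDerivativeOnUniv :=
        { add := fun {f h x} hf hh _ =>
            mvfderiv_add (trivial_diffAt.1 hf) (trivial_diffAt.1 hh)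
          leibniz := fun {f h x} hf hh _ =>
            mvfderiv_smul hh (trivial_diffAt.1 hf) } }
  hol_conn U hU := by
    constructor
    intro f hf x hx
    have hfx : ContMDiffAt 𝓘(ℂ, V) 𝓘(ℂ, ℂ) ω f x :=
      trivial_holAt.1 ((hf x hx).contMDiffAt (hU.mem_nhds hx))
    refine ContMDiffAt.contMDiffWithinAt ?_
    refine ((hom_iff (HolLineBundle.trivial V X) (s := fun _ => (1 : ℂ))
      (trivial_holAt.2 contMDiffAt_const)
      (one_ne_zero (α := ℂ)) _).2 (holFormAt_d hfx)).congr_of_eventuallyEq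
        (Filter.Eventually.of_forall fun y => ?_)
    refine congrArg _ (ContinuousLinearMap.ext fun v => ?_)
    exact (mul_one (mvfderiv 𝓘(ℂ, V) f y v)).symm

theorem holAt_map {φ : ∀ x, A.fiber x ≃ₗ[ℂ] B.fiber x} {e s : ∀ x, A.fiber x}
    {f : ∀ x, B.fiber x} {x : X} (he : A.HolAt e x) (he0 : e x ≠ 0) (hf : B.HolAt f x)
    (h : ∀ᶠ y in 𝓝 x, φ y (e y) = f y) (hs : A.HolAt s x) :
    B.HolAt (fun y => φ y (s y)) x := by
  obtain ⟨k, hk, hks⟩ := exists_coeff he he0 hs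
  refine (hf.smul hk).congr ?_
  filter_upwards [h, hks] with y h1 h2
  rw [h2, map_smul, h1]

theorem conn_map {φ : ∀ x, A.fiber x ≃ₗ[ℂ] B.fiber x} {e s : ∀ x, A.fiber x}
    {f : ∀ x, B.fiber x} {x : X} (he : A.HolAt e x) (he0 : e x ≠ 0) (hf : B.HolAt f x)
    (h : ∀ᶠ y in 𝓝 x, φ y (e y) = f y) (hs : A.HolAt s x)
    {α : TangentSpace 𝓘(ℂ, V) x →L[ℂ] ℂ} (hA : A.conn e x = α.smulRight (e x))
    (hB : B.conn f x = α.smulRight (f x)) (v : TangentSpace 𝓘(ℂ, V) x) :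
    B.conn (fun y => φ y (s y)) x v = φ x (A.conn s x v) := by
  obtain ⟨k, hk, hks⟩ := exists_coeff he he0 hs
  have hk' := hk.mdifferentiableAt (by simp)
  rw [conn_smul he.diffAt hk' hks, conn_smul (A := B) (e := f) (f := k) hf.diffAt hk' (by
    filter_upwards [h, hks] with y h1 h2
    rw [h2, map_smul, h1]), hA, hB]
  simp [h.self_of_nhds]

/-- `A` has local frames `e i` on the members of the open cover `U`, with
transition functions `g` and connection forms `α`. -/
structure Rep (A : ConnLineBundle V X) (U : X → Set X) (g : X → X → X → ℂ)
    (α : X → ∀ x : X, TangentSpace 𝓘(ℂ, V) x →L[ℂ] ℂ) : Prop where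
  isOpen : ∀ i, IsOpen (U i)
  mem : ∀ i, i ∈ U i
  ex : ∃ e : X → ∀ x, A.fiber x, ∀ i, ∀ x ∈ U i, A.HolAt (e i) x ∧ e i x ≠ 0 ∧
    A.conn (e i) x = (α i x).smulRight (e i x) ∧ ∀ j, x ∈ U j → e i x = g i j x • e j x

theorem rep_self (A : ConnLineBundle V X) : A.Rep A.dom A.trans A.connForm where
  isOpen := A.isOpen_dom
  mem := A.mem_dom
  ex := ⟨A.frame, fun _ _ hx => ⟨holAt_frame hx, frame_ne_zero hx, conn_frame hx,
    fun _ hj => (trans_smul hj).symm⟩⟩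

/-- The linear identification of the fibre at `x` with `ℂ` -/
def coordEquiv (A : ConnLineBundle V X) (x : X) : A.fiber x ≃ₗ[ℂ] ℂ where
  toFun := A.coord x x
  map_add' := map_add _
  map_smul' := map_smul _
  invFun c := c • A.frame x x
  left_inv v := coord_smul_frame (A.mem_dom x) v
  right_inv c := by simp [coord_frame (A.mem_dom x)]

theorem exists_equiv {x : X} {v : A.fiber x} {w : B.fiber x} (hv : v ≠ 0) (hw : w ≠ 0) :
    ∃ φ : A.fiber x ≃ₗ[ℂ] B.fiber x, φ v = w := by
  have h1 : A.coordEquiv x v ≠ 0 := by simpa using hv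
  have h2 : B.coordEquiv x w ≠ 0 := by simpa using hw
  refine ⟨(A.coordEquiv x).trans ((LinearEquiv.smulOfNeZero ℂ ℂ _
    (div_ne_zero h2 h1)).trans (B.coordEquiv x).symm), ?_⟩
  rw [LinearEquiv.trans_apply, LinearEquiv.trans_apply, LinearEquiv.symm_apply_eq]
  simp [div_mul_cancel₀ _ h1]

theorem Rep.iso {U U' : X → Set X} {g g' : X → X → X → ℂ}
    {α α' : X → ∀ x : X, TangentSpace 𝓘(ℂ, V) x →L[ℂ] ℂ} (hA : A.Rep U g α) (hB : B.Rep U' g' α')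
    (hg : ∀ i j x, x ∈ U i → x ∈ U' i → x ∈ U j → x ∈ U' j → g i j x = g' i j x)
    (hα : ∀ i x, x ∈ U i → x ∈ U' i → α i x = α' i x) : Nonempty (Iso A B) := by
  obtain ⟨e, he⟩ := hA.ex
  obtain ⟨f, hf⟩ := hB.ex
  choose φ hφ using fun x => exists_equiv (he x x (hA.mem x)).2.1 (hf x x (hB.mem x)).2.1
  have key : ∀ i x, x ∈ U i → x ∈ U' i → φ x (e i x) = f i x := by
    intro i x h1 h2
    rw [(he i x h1).2.2.2 x (hA.mem x), (hf i x h2).2.2.2 x (hB.mem x), map_smul, hφ,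
      hg i x x h1 h2 (hA.mem x) (hB.mem x)]
  have ev : ∀ x, ∀ᶠ y in 𝓝 x, φ y (e x y) = f x y := fun x => by
    filter_upwards [(hA.isOpen x).mem_nhds (hA.mem x), (hB.isOpen x).mem_nhds (hB.mem x)]
      with y h1 h2 using key x y h1 h2
  refine ⟨⟨φ, fun s x => ⟨fun h => ?_, fun h => ?_⟩, fun s x hs v => ?_⟩⟩
  · have := holAt_map (φ := fun y => (φ y).symm) (he := (hf x x (hB.mem x)).1)
      (hf x x (hB.mem x)).2.1 (he x x (hA.mem x)).1 (by
        filter_upwards [ev x] with y hy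
        rw [← hy, LinearEquiv.symm_apply_apply]) h
    simpa using this
  · exact holAt_map (he x x (hA.mem x)).1 (he x x (hA.mem x)).2.1 (hf x x (hB.mem x)).1 (ev x) h
  · exact conn_map (he x x (hA.mem x)).1 (he x x (hA.mem x)).2.1 (hf x x (hB.mem x)).1 (ev x) hs
      (he x x (hA.mem x)).2.2.1
      (by rw [hα x x (hA.mem x) (hB.mem x)]; exact (hf x x (hB.mem x)).2.2.1) v

theorem Rep.map {U : X → Set X} {g : X → X → X → ℂ}
    {α : X → ∀ x : X, TangentSpace 𝓘(ℂ, V) x →L[ℂ] ℂ} (hA : A.Rep U g α) (φ : Iso A B) :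
    B.Rep U g α := by
  obtain ⟨e, he⟩ := hA.ex
  refine ⟨hA.isOpen, hA.mem, fun i x => φ.toEquiv x (e i x), fun i x hx => ?_⟩
  obtain ⟨h1, h2, h3, h4⟩ := he i x hx
  refine ⟨(φ.hol_iff _ _).2 h1, by simpa using h2, ?_, fun j hj => ?_⟩
  · ext v
    rw [φ.conn_apply _ _ h1, h3]
    simp
  · simp only [h4 j hj, map_smul]

theorem rep_trivial : (trivial V X).Rep (fun _ => univ) (fun _ _ _ => 1) (fun _ _ => 0) where
  isOpen _ := isOpen_univ
  mem _ := mem_univ _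
  ex := by
    refine ⟨fun _ _ => (1 : ℂ), fun i x _ => ⟨trivial_holAt.2 contMDiffAt_const,
      one_ne_zero (α := ℂ), ?_, fun j _ => (one_smul ℂ (1 : ℂ)).symm⟩⟩
    have := mvfderiv_const (I := 𝓘(ℂ, V)) (1 : ℂ) (x := x)
    refine Eq.trans this ?_
    ext v
    exact (zero_mul (1 : ℂ)).symm

theorem withConn_frame {L : HolLineBundle V X} {α : X → ∀ x : X, TangentSpace 𝓘(ℂ, V) x →L[ℂ] ℂ}
    (hol) (compat) {i x : X} (hx : x ∈ L.dom i) :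
    (L.withConn α hol compat).conn (L.frame i) x = (α i x).smulRight (L.frame i x) := by
  have h := withConn_aux compat hx (holAt_frame hx).diffAt
  refine h.trans ?_
  have h1 : (fun y => L.coord i y (L.frame i y)) =ᶠ[𝓝 x] fun _ => 1 := by
    filter_upwards [L.dom_mem_nhds hx] with y hy using coord_frame hy
  rw [mvfderiv_congr h1, mvfderiv_const, coord_frame hx]
  simp

theorem conn_tensor_frame {i x : X} (hx : x ∈ (A.tensor B).dom i) :
    (A.tensor B).conn ((A.tensor B).frame i) x =
      (A.connForm i x + B.connForm i x).smulRight ((A.tensor B).frame i x) :=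
  withConn_frame _ _ hx

theorem conn_dual_frame {i x : X} (hx : x ∈ A.dual.dom i) :
    A.dual.conn (A.dual.frame i) x = (- A.connForm i x).smulRight (A.dual.frame i x) :=
  withConn_frame _ _ hx

/-- `s ⊗ t` as a vector of the tensor product -/
def tmul (A B : ConnLineBundle V X) (x : X) (v : A.fiber x) (w : B.fiber x) :
    (A.tensor B).fiber x := HolLineBundle.tmul A.toHolLineBundle B.toHolLineBundle x v w

theorem tmul_def (x : X) (v : A.fiber x) (w : B.fiber x) :
    tmul A B x v w = (A.coord x x v * B.coord x x w) • (A.tensor B).frame x x := rfl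

theorem tmul_smul (x : X) (a b : ℂ) (v : A.fiber x) (w : B.fiber x) :
    tmul A B x (a • v) (b • w) = (a * b) • tmul A B x v w := by
  simp only [tmul_def, map_smul, smul_eq_mul]
  module

theorem tmul_smul_left (x : X) (a : ℂ) (v : A.fiber x) (w : B.fiber x) :
    tmul A B x (a • v) w = a • tmul A B x v w := by
  simp only [tmul_def, map_smul, smul_eq_mul]
  module

theorem tmul_smul_right (x : X) (b : ℂ) (v : A.fiber x) (w : B.fiber x) :
    tmul A B x v (b • w) = b • tmul A B x v w := by
  simp only [tmul_def, map_smul, smul_eq_mul]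
  module

theorem tmul_eq' {i x : X} (hi : x ∈ (A.tensor B).dom i) (v : A.fiber x) (w : B.fiber x) :
    tmul A B x v w = (A.coord i x v * B.coord i x w) • (A.tensor B).frame i x :=
  HolLineBundle.tmul_eq hi v w

/-- The inverse of a nonzero vector, as a vector of the dual bundle -/
def vinv (A : ConnLineBundle V X) (x : X) (v : A.fiber x) : A.dual.fiber x :=
  HolLineBundle.vinv A.toHolLineBundle x v

theorem vinv_def (x : X) (v : A.fiber x) :
    vinv A x v = (A.coord x x v)⁻¹ • A.dual.frame x x := rfl

theorem vinv_eq' {i x : X} (hi : x ∈ A.dom i) (v : A.fiber x) :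
    vinv A x v = (A.coord i x v)⁻¹ • A.dual.frame i x := HolLineBundle.vinv_eq hi v

theorem coord_conn {s : ∀ x, A.fiber x} {i x : X} (hx : x ∈ A.dom i) (hs : A.DiffAt s x)
    (v : TangentSpace 𝓘(ℂ, V) x) : A.coord i x (A.conn s x v) =
      mvfderiv 𝓘(ℂ, V) (fun y => A.coord i y (s y)) x v + A.coord i x (s x) * A.connForm i x v := by
  rw [conn_smul (A := A) (holAt_frame hx).diffAt ((diffAt_iff' hx).1 hs) (by
    filter_upwards [A.dom_mem_nhds hx] with y hy using (coord_smul_frame hy _).symm),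
    conn_frame hx]
  simp [coord_frame hx]
  ring

theorem holAt_tmul {s : ∀ x, A.fiber x} {t : ∀ x, B.fiber x} {x : X} (hs : A.HolAt s x)
    (ht : B.HolAt t x) : (A.tensor B).HolAt (fun y => tmul A B y (s y) (t y)) x := by
  have hx := (A.tensor B).mem_dom x
  refine ((holAt_frame hx).smul (((holAt_iff (A.mem_dom x)).1 hs).mul
    ((holAt_iff (B.mem_dom x)).1 ht))).congr ?_
  filter_upwards [(A.tensor B).dom_mem_nhds hx] with y hy
  exact tmul_eq' hy _ _

/-- `∇ (s ⊗ t) = ∇ s ⊗ t + s ⊗ ∇ t` -/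
theorem conn_tmul {s : ∀ x, A.fiber x} {t : ∀ x, B.fiber x} {x : X} (hs : A.DiffAt s x)
    (ht : B.DiffAt t x) (v : TangentSpace 𝓘(ℂ, V) x) :
    (A.tensor B).conn (fun y => tmul A B y (s y) (t y)) x v =
      tmul A B x (A.conn s x v) (t x) + tmul A B x (s x) (B.conn t x v) := by
  have hx := (A.tensor B).mem_dom x
  have hs' := diffAt_iff.1 hs
  have ht' := diffAt_iff.1 ht
  rw [conn_smul (A := A.tensor B) (e := (A.tensor B).frame x) (holAt_frame hx).diffAt (hs'.mul ht') (by
    filter_upwards [(A.tensor B).dom_mem_nhds hx] with y hy using tmul_eq' hy _ _),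
    conn_tensor_frame hx, mvfderiv_mul hs' ht', tmul_def, tmul_def,
    coord_conn (A.mem_dom x) hs, coord_conn (B.mem_dom x) ht]
  simp only [ContinuousLinearMap.smulRight_apply, _root_.add_apply, _root_.smul_apply,
    smul_eq_mul, Pi.mul_apply]
  module

theorem Rep.tensor {U U' : X → Set X} {g g' : X → X → X → ℂ}
    {α α' : X → ∀ x : X, TangentSpace 𝓘(ℂ, V) x →L[ℂ] ℂ} (hA : A.Rep U g α)
    (hB : B.Rep U' g' α') : (A.tensor B).Rep (fun i => U i ∩ U' i)
      (fun i j x => g i j x * g' i j x) (fun i x => α i x + α' i x) := by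
  obtain ⟨e, he⟩ := hA.ex
  obtain ⟨f, hf⟩ := hB.ex
  refine ⟨fun i => (hA.isOpen i).inter (hB.isOpen i), fun i => ⟨hA.mem i, hB.mem i⟩,
    fun i x => tmul A B x (e i x) (f i x), fun i x hx => ?_⟩
  obtain ⟨h1, h2, h3, h4⟩ := he i x hx.1
  obtain ⟨k1, k2, k3, k4⟩ := hf i x hx.2
  refine ⟨holAt_tmul h1 k1, ?_, ?_, fun j hj => ?_⟩
  · refine smul_ne_zero (mul_ne_zero ?_ ?_) (frame_ne_zero ((A.tensor B).mem_dom x))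
    · exact fun h => h2 (eq_of_coord (A.mem_dom x) (by rw [h, map_zero]))
    · exact fun h => k2 (eq_of_coord (B.mem_dom x) (by rw [h, map_zero]))
  · ext v
    rw [conn_tmul h1.diffAt k1.diffAt, h3, k3]
    simp only [ContinuousLinearMap.smulRight_apply, tmul_smul_left, tmul_smul_right,
      _root_.add_apply]
    module
  · simp only [h4 j hj.1, k4 j hj.2, tmul_smul]

theorem Rep.dual {U : X → Set X} {g : X → X → X → ℂ}
    {α : X → ∀ x : X, TangentSpace 𝓘(ℂ, V) x →L[ℂ] ℂ} (hA : A.Rep U g α) :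
    A.dual.Rep U (fun i j x => (g i j x)⁻¹) (fun i x => - α i x) := by
  obtain ⟨e, he⟩ := hA.ex
  refine ⟨hA.isOpen, hA.mem, fun i x => vinv A x (e i x), fun i x hx => ?_⟩
  obtain ⟨h1, h2, h3, h4⟩ := he i x hx
  have hxd := A.dual.mem_dom x
  have hc : A.coord x x (e i x) ≠ 0 :=
    fun h => h2 (eq_of_coord (A.mem_dom x) (by rw [h, map_zero]))
  have hhol := (holAt_iff (A.mem_dom x)).1 h1
  have hinv := hhol.inv₀ hc
  have hev : ∀ᶠ y in 𝓝 x, vinv A y (e i y) =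
      (A.coord x y (e i y))⁻¹ • A.dual.frame x y := by
    filter_upwards [A.dom_mem_nhds (A.mem_dom x)] with y hy using vinv_eq' hy _
  refine ⟨((holAt_frame hxd).smul hinv).congr hev, smul_ne_zero (inv_ne_zero hc)
    (frame_ne_zero hxd), ?_, fun j hj => ?_⟩
  · have hmul : (fun y => A.coord x y (e i y)) * (fun y => (A.coord x y (e i y))⁻¹) =ᶠ[𝓝 x]
        fun _ => 1 := by
      filter_upwards [hhol.continuousAt.eventually_ne hc] with y hy using mul_inv_cancel₀ hy
    have hd := mvfderiv_congr (V := V) hmul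
    rw [mvfderiv_const, mvfderiv_mul (hhol.mdifferentiableAt (by simp))
      (hinv.mdifferentiableAt (by simp))] at hd
    rw [conn_smul (A := A.dual) (e := A.dual.frame x) (holAt_frame hxd).diffAt (hinv.mdifferentiableAt (by simp)) hev,
      conn_dual_frame hxd]
    ext v
    have hdv := congrArg (fun T => T v) hd
    have hcv := coord_conn (A.mem_dom x) h1.diffAt v
    rw [h3] at hcv
    simp only [ContinuousLinearMap.smulRight_apply, _root_.add_apply, _root_.smul_apply,
      _root_.neg_apply, _root_.zero_apply, smul_eq_mul, map_smul, vinv_def] at hdv hcv ⊢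
    rw [smul_smul, smul_smul, ← add_smul]
    congr 1
    refine mul_left_cancel₀ hc ?_
    linear_combination hdv + (A.coord x x (e i x))⁻¹ * hcv
  · simp only [h4 j hj, vinv_def, map_smul, smul_eq_mul, mul_inv, smul_smul]

end ConnLineBundle

/-- The expression of a cotangent field in the chart at `i`. -/
def chartCov (β : ∀ x : X, TangentSpace 𝓘(ℂ, V) x →L[ℂ] ℂ) (i : X) (z : V) : V →L[ℂ] ℂ :=
  (β ((extChartAt 𝓘(ℂ, V) i).symm z)).comp (chartSymmD i z)

theorem chartD_self (x : X) (v : TangentSpace 𝓘(ℂ, V) x) : chartD x x v = v := by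
  have := mfderiv_extChartAt_self (I := 𝓘(ℂ, V)) (x := x)
  exact congrArg (fun T : V →L[ℂ] V => T v) this

theorem chartCov_self (β : ∀ x : X, TangentSpace 𝓘(ℂ, V) x →L[ℂ] ℂ) (x : X)
    (v : TangentSpace 𝓘(ℂ, V) x) :
    chartCov β x (extChartAt 𝓘(ℂ, V) x x) (chartD x x v) = β x v := by
  have h1 : ∀ y : X, y = x → (β y : V →L[ℂ] ℂ) = (β x : V →L[ℂ] ℂ) := by
    rintro _ rfl; rfl
  have h2 := h1 _ (extChartAt_to_inv (I := 𝓘(ℂ, V)) x)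
  have h3 : (chartSymmD x (extChartAt 𝓘(ℂ, V) x x) : V →L[ℂ] V) (chartD x x v : V) = v := by
    have := mfderivWithin_extChartAt_symm_comp_mfderiv_extChartAt' (I := 𝓘(ℂ, V)) (x := x)
      (mem_extChartAt_source (I := 𝓘(ℂ, V)) x)
    rw [modelWithCornersSelf_coe, range_id, mfderivWithin_univ] at this
    exact congrArg (fun T : V →L[ℂ] V => T v) this
  calc _ = (β ((extChartAt 𝓘(ℂ, V) x).symm (extChartAt 𝓘(ℂ, V) x x)) : V →L[ℂ] ℂ)
        ((chartSymmD x (extChartAt 𝓘(ℂ, V) x x) : V →L[ℂ] V) (chartD x x v : V)) := rfl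
    _ = _ := by rw [h3]; exact congrArg (fun T : V →L[ℂ] ℂ => T v) h2

theorem holFormAt_chartCov {β : ∀ x : X, TangentSpace 𝓘(ℂ, V) x →L[ℂ] ℂ} {x : X}
    (h : HolFormAt (oneForm β) x) :
    DifferentiableAt ℂ (chartCov β x) (extChartAt 𝓘(ℂ, V) x x) :=
  ((holFormAt_oneForm β x).1 h).differentiableAt (by simp)

theorem extD_oneForm {β : ∀ x : X, TangentSpace 𝓘(ℂ, V) x →L[ℂ] ℂ} {x : X}
    (h : HolFormAt (oneForm β) x) (v w : TangentSpace 𝓘(ℂ, V) x) :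
    extD (oneForm β) x ![v, w] =
      fderiv ℂ (chartCov β x) (extChartAt 𝓘(ℂ, V) x x) (chartD x x v) (chartD x x w) -
      fderiv ℂ (chartCov β x) (extChartAt 𝓘(ℂ, V) x x) (chartD x x w) (chartD x x v) := by
  have hd := holFormAt_chartCov h
  have h0 : DifferentiableAt ℂ (chartForm (oneForm β) x) (extChartAt 𝓘(ℂ, V) x x) :=
    ContDiffAt.differentiableAt h (by simp)
  have h1 : extD (oneForm β) x ![v, w] = extDeriv (chartForm (oneForm β) x)
      (extChartAt 𝓘(ℂ, V) x x) ![chartD x x v, chartD x x w] := by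
    unfold extD
    rw [ContinuousAlternatingMap.compContinuousLinearMap_apply]
    congr 1
    ext i; fin_cases i <;> rfl
  have h2 : ∀ u : V, (fun z => chartForm (oneForm β) x z ![u]) = fun z => chartCov β x z u := by
    intro u; ext z; rfl
  have h3 : ∀ u u' : V, fderiv ℂ (fun z => chartCov β x z u) (extChartAt 𝓘(ℂ, V) x x) u' =
      fderiv ℂ (chartCov β x) (extChartAt 𝓘(ℂ, V) x x) u' u := by
    intro u u'
    rw [fderiv_clm_apply hd (differentiableAt_const _)]
    simp
  rw [h1, extDeriv_apply h0]
  have e0 : (0 : Fin 2).removeNth ![chartD x x v, chartD x x w] = ![chartD x x w] := by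
    ext i; fin_cases i; rfl
  have e1 : (1 : Fin 2).removeNth ![chartD x x v, chartD x x w] = ![chartD x x v] := by
    ext i; fin_cases i; rfl
  rw [Fin.sum_univ_two, e0, e1, h2, h2, h3, h3]
  simp [sub_eq_add_neg]

theorem chartCov_d {f : X → ℂ} {x : X} (hf : ContMDiffAt 𝓘(ℂ, V) 𝓘(ℂ, ℂ) ω f x) :
    chartCov (mvfderiv 𝓘(ℂ, V) f) x =ᶠ[𝓝 (extChartAt 𝓘(ℂ, V) x x)]
      fderiv ℂ (f ∘ (extChartAt 𝓘(ℂ, V) x).symm) := by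
  have h1 := (contMDiffAt_iff_contMDiffAt_nhds (by simp)).1 hf
  have h2 := (continuousAt_extChartAt_symm (I := 𝓘(ℂ, V)) x)
  have h3 : ∀ᶠ z in 𝓝 (extChartAt 𝓘(ℂ, V) x x),
      ContMDiffAt 𝓘(ℂ, V) 𝓘(ℂ, ℂ) ω f ((extChartAt 𝓘(ℂ, V) x).symm z) := by
    refine h2.eventually ?_
    rwa [extChartAt_to_inv]
  filter_upwards [h3, (isOpen_extChartAt_target x).mem_nhds (mem_extChartAt_target x)] with z hz hzt
  have h4 : MDifferentiableAt 𝓘(ℂ, V) 𝓘(ℂ, V) (extChartAt 𝓘(ℂ, V) x).symm z := by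
    have := mdifferentiableWithinAt_extChartAt_symm (I := 𝓘(ℂ, V)) hzt
    rwa [modelWithCornersSelf_coe, range_id, mdifferentiableWithinAt_univ] at this
  have h5 := mfderiv_comp z (hz.mdifferentiableAt (by simp)) h4
  rw [mfderiv_eq_fderiv] at h5
  exact h5.symm

namespace ConnLineBundle

open HolLineBundle

variable {A B C : ConnLineBundle V X}

/-- The curvature is the exterior derivative of the connection form of a local frame. -/
theorem nablaTwo_eq {x : X} {e s t : ∀ x, A.fiber x}
    {α η : ∀ x : X, TangentSpace 𝓘(ℂ, V) x →L[ℂ] ℂ} (he : A.HolAt e x) (he0 : e x ≠ 0)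
    (hα : HolFormAt (oneForm α) x) (hconn : ∀ᶠ y in 𝓝 x, A.conn e y = (α y).smulRight (e y))
    (hs : A.HolAt s x) (ht : A.HolAt t x) (hη : HolFormAt (oneForm η) x)
    (h : ∀ᶠ y in 𝓝 x, A.conn s y = (η y).smulRight (t y)) (v w : TangentSpace 𝓘(ℂ, V) x) :
    A.nablaTwo η t x v w = extD (oneForm α) x ![v, w] • s x := by
  obtain ⟨f, hf, hfs⟩ := exists_coeff he he0 hs
  obtain ⟨k, hk, hkt⟩ := exists_coeff he he0 ht
  have hd : ∀ {f : X → ℂ} {s : ∀ x, A.fiber x}, ContMDiffAt 𝓘(ℂ, V) 𝓘(ℂ, ℂ) ω f x →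
      (∀ᶠ y in 𝓝 x, s y = f y • e y) → ∀ᶠ y in 𝓝 x, A.conn s y =
        (f y • α y + mvfderiv 𝓘(ℂ, V) f y).smulRight (e y) := by
    intro f s hf hs
    have hf' := (contMDiffAt_iff_contMDiffAt_nhds (by simp)).1 hf
    have he' := (contMDiffAt_iff_contMDiffAt_nhds (by simp)).1
      ((HolLineBundle.holAt_iff (A.mem_dom x)).1 he)
    filter_upwards [hf', he', A.dom_mem_nhds (A.mem_dom x), hs.eventually_nhds, hconn]
      with y h1 h2 h3 h4 h5
    rw [conn_smul ((HolLineBundle.holAt_iff h3).2 h2).diffAt (h1.mdifferentiableAt (by simp)) h4, h5]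
    ext v
    simp [add_smul, smul_smul]
  have hne : ∀ᶠ y in 𝓝 x, e y ≠ 0 := by
    have h1 := (HolLineBundle.holAt_iff (A.mem_dom x)).1 he
    have h0 : A.coord x x (e x) ≠ 0 := fun h =>
      he0 (eq_of_coord (A.mem_dom x) (by rw [h, map_zero]))
    filter_upwards [h1.continuousAt.eventually_ne h0] with y hy h
    exact hy (by simp [h])
  have hrel : ∀ᶠ y in 𝓝 x, f y • α y + mvfderiv 𝓘(ℂ, V) f y = k y • η y := by
    filter_upwards [hd hf hfs, h, hkt, hne] with y h1 h2 h3 h4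
    ext v
    have := congrArg (fun T => T v) (h1.symm.trans h2)
    simp only [ContinuousLinearMap.smulRight_apply, h3, smul_smul] at this
    have := smul_left_injective ℂ h4 this
    simpa [mul_comm] using this
  -- pass to the chart at `x`
  set z := extChartAt 𝓘(ℂ, V) x x with hz
  set ψ := (extChartAt 𝓘(ℂ, V) x).symm with hψ
  have hψz : ψ z = x := extChartAt_to_inv x
  have hψc : ContinuousAt ψ z := continuousAt_extChartAt_symm x
  have hF : ∀ {f : X → ℂ}, ContMDiffAt 𝓘(ℂ, V) 𝓘(ℂ, ℂ) ω f x → ContDiffAt ℂ ω (f ∘ ψ) z := by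
    intro f hf
    have := contMDiffAt_iff_source.1 hf
    rw [modelWithCornersSelf_coe, range_id, contMDiffWithinAt_univ,
      contMDiffAt_iff_contDiffAt] at this
    exact this
  have hrel' : (fun y => (f ∘ ψ) y • chartCov α x y + fderiv ℂ (f ∘ ψ) y) =ᶠ[𝓝 z]
      fun y => (k ∘ ψ) y • chartCov η x y := by
    have h1 : ∀ᶠ y in 𝓝 z, f (ψ y) • α (ψ y) + mvfderiv 𝓘(ℂ, V) f (ψ y) = k (ψ y) • η (ψ y) := by
      refine hψc.eventually
        (p := fun y => f y • α y + mvfderiv 𝓘(ℂ, V) f y = k y • η y) ?_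
      rwa [hψz]
    filter_upwards [h1, chartCov_d hf] with y hy hy'
    rw [← hy']
    ext u
    exact congrArg (fun T => T (chartSymmD x y u)) hy
  have hF1 := (hF hf).differentiableAt (by simp)
  have hK1 := (hF hk).differentiableAt (by simp)
  have hF2 : DifferentiableAt ℂ (fderiv ℂ (f ∘ ψ)) z :=
    ((hF hf).fderiv_right (m := 1) (by simp)).differentiableAt (by simp)
  have ha := holFormAt_chartCov hα
  have hh := holFormAt_chartCov hη
  have hsymm := ((hF hf).isSymmSndFDerivAt (by simp)).eq (chartD x x v) (chartD x x w)
  have hder := hrel'.fderiv_eq (𝕜 := ℂ)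
  rw [fderiv_fun_add (hF1.fun_smul ha) hF2, fderiv_fun_smul (𝕜 := ℂ) hF1 ha, fderiv_fun_smul (𝕜 := ℂ) hK1 hh] at hder
  have hvw := congrArg (fun T => T (chartD x x v) (chartD x x w)) hder
  have hwv := congrArg (fun T => T (chartD x x w) (chartD x x v)) hder
  have hct := (hd hk hkt).self_of_nhds
  have hr := hrel.self_of_nhds
  have hdk : ∀ u, fderiv ℂ (k ∘ ψ) z (chartD x x u) = mvfderiv 𝓘(ℂ, V) k x u := fun u => by
    rw [← (chartCov_d hk).self_of_nhds, chartCov_self]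
  have hdf : ∀ u, fderiv ℂ (f ∘ ψ) z (chartD x x u) = mvfderiv 𝓘(ℂ, V) f x u := fun u => by
    rw [← (chartCov_d hf).self_of_nhds, chartCov_self]
  have hca : ∀ u, chartCov α x z (chartD x x u) = α x u := chartCov_self α x
  have hcη : ∀ u, chartCov η x z (chartD x x u) = η x u := chartCov_self η x
  have hav := fun u => congrArg (fun T => T u) hr
  have hv := hav v
  have hw := hav w
  unfold nablaTwo
  rw [extD_oneForm hα, extD_oneForm hη, hct, hkt.self_of_nhds, hfs.self_of_nhds]
  simp only [ContinuousLinearMap.smulRight_apply, _root_.add_apply, _root_.smul_apply,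
    smul_eq_mul, Function.comp_apply, hψz, hdk, hdf, hca, hcη,
    smul_smul, ← sub_smul] at hvw hwv hv hw ⊢
  congr 1
  linear_combination hwv - hvw + hsymm + α x w * hv - α x v * hw

end ConnLineBundle

theorem extD_oneForm_add {α β : ∀ x : X, TangentSpace 𝓘(ℂ, V) x →L[ℂ] ℂ} {x : X}
    (hα : HolFormAt (oneForm α) x) (hβ : HolFormAt (oneForm β) x)
    (hαβ : HolFormAt (oneForm fun y => α y + β y) x) (v w : TangentSpace 𝓘(ℂ, V) x) :
    extD (oneForm fun y => α y + β y) x ![v, w] =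
      extD (oneForm α) x ![v, w] + extD (oneForm β) x ![v, w] := by
  have h : chartCov (fun y => α y + β y) x = fun z => chartCov α x z + chartCov β x z := by
    ext z u; rfl
  rw [extD_oneForm hα, extD_oneForm hβ, extD_oneForm hαβ, h,
    fderiv_fun_add (holFormAt_chartCov hα) (holFormAt_chartCov hβ)]
  simp only [_root_.add_apply]
  ring

theorem extD_oneForm_neg {α : ∀ x : X, TangentSpace 𝓘(ℂ, V) x →L[ℂ] ℂ} {x : X}
    (hα : HolFormAt (oneForm α) x) (hα' : HolFormAt (oneForm fun y => - α y) x)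
    (v w : TangentSpace 𝓘(ℂ, V) x) :
    extD (oneForm fun y => - α y) x ![v, w] = - extD (oneForm α) x ![v, w] := by
  have h : chartCov (fun y => - α y) x = fun z => - chartCov α x z := by
    ext z u; rfl
  rw [extD_oneForm hα, extD_oneForm hα', h, fderiv_fun_neg]
  simp only [_root_.neg_apply]
  ring

namespace ConnLineBundle

open HolLineBundle

variable {A B C D : ConnLineBundle V X}

/-- The connection is integrable: `∇² (∇ s) = 0` for all local holomorphic sections `s`, where
`∇ s` is written locally as `η ⊗ t`. -/
def Integrable (A : ConnLineBundle V X) : Prop :=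
  ∀ (x : X) (s t : ∀ x, A.fiber x) (η : ∀ x : X, TangentSpace 𝓘(ℂ, V) x →L[ℂ] ℂ),
    A.HolAt s x → A.HolAt t x → HolFormAt (oneForm η) x →
    (∀ᶠ y in 𝓝 x, A.conn s y = (η y).smulRight (t y)) →
    ∀ v w, A.nablaTwo η t x v w = 0

section Rep

variable {U U' : X → Set X} {g g' : X → X → X → ℂ}
    {α α' : X → ∀ x : X, TangentSpace 𝓘(ℂ, V) x →L[ℂ] ℂ}

theorem Rep.hol (hA : A.Rep U g α) {i x : X} (hx : x ∈ U i) : HolFormAt (oneForm (α i)) x := by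
  obtain ⟨e, he⟩ := hA.ex
  rw [← hom_iff A.toHolLineBundle (he i x hx).1 (he i x hx).2.1]
  refine (hol_conn_at (he i x hx).1).congr_of_eventuallyEq ?_
  filter_upwards [(hA.isOpen i).mem_nhds hx] with y hy
  rw [(he i y hy).2.2.1]

theorem Rep.integrable_iff (hA : A.Rep U g α) : A.Integrable ↔
    ∀ i, ∀ x ∈ U i, ∀ v w, extD (oneForm (α i)) x ![v, w] = 0 := by
  obtain ⟨e, he⟩ := hA.ex
  have hc : ∀ i x, x ∈ U i → ∀ᶠ y in 𝓝 x, A.conn (e i) y = (α i y).smulRight (e i y) := by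
    intro i x hx
    filter_upwards [(hA.isOpen i).mem_nhds hx] with y hy using (he i y hy).2.2.1
  constructor
  · intro h i x hx v w
    obtain ⟨h1, h2, -, -⟩ := he i x hx
    have h3 := h x (e i) (e i) (α i) h1 h1 (hA.hol hx) (hc i x hx) v w
    rw [nablaTwo_eq h1 h2 (hA.hol hx) (hc i x hx) h1 h1 (hA.hol hx) (hc i x hx)] at h3
    exact (smul_eq_zero.1 h3).resolve_right h2
  · intro h x s t η hs ht hη hst v w
    obtain ⟨h1, h2, -, -⟩ := he x x (hA.mem x)
    rw [nablaTwo_eq h1 h2 (hA.hol (hA.mem x)) (hc x x (hA.mem x)) hs ht hη hst,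
      h x x (hA.mem x), zero_smul]

end Rep

theorem Integrable.tensor (hA : A.Integrable) (hB : B.Integrable) : (A.tensor B).Integrable := by
  have hAB := A.rep_self.tensor B.rep_self
  refine hAB.integrable_iff.2 fun i x hx v w => ?_
  rw [extD_oneForm_add (A.rep_self.hol hx.1) (B.rep_self.hol hx.2) (hAB.hol hx),
    A.rep_self.integrable_iff.1 hA i x hx.1, B.rep_self.integrable_iff.1 hB i x hx.2, add_zero]

theorem Integrable.dual (hA : A.Integrable) : A.dual.Integrable := by
  refine A.rep_self.dual.integrable_iff.2 fun i x hx v w => ?_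
  rw [extD_oneForm_neg (A.rep_self.hol hx) (A.rep_self.dual.hol hx),
    A.rep_self.integrable_iff.1 hA i x hx, neg_zero]

theorem integrable_trivial : (trivial V X).Integrable := by
  refine rep_trivial.integrable_iff.2 fun i x hx v w => ?_
  have h : chartCov (fun y : X => (0 : TangentSpace 𝓘(ℂ, V) y →L[ℂ] ℂ)) x = fun _ => 0 := by
    ext z u; rfl
  rw [extD_oneForm (rep_trivial.hol (i := i) hx), h]
  simp

/-! ### Isomorphism classes -/

variable (V X) in
/-- Two line bundles with connection are equivalent if they are isomorphic. -/
def isoSetoid : Setoid (ConnLineBundle V X) where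
  r A B := Nonempty (Iso A B)
  iseqv :=
    { refl := fun A => A.rep_self.iso A.rep_self (fun _ _ _ _ _ _ _ => rfl) (fun _ _ _ _ => rfl)
      symm := fun {A _} ⟨φ⟩ => (A.rep_self.map φ).iso A.rep_self
        (fun _ _ _ _ _ _ _ => rfl) (fun _ _ _ _ => rfl)
      trans := fun {A _ _} ⟨φ⟩ ⟨ψ⟩ => A.rep_self.iso ((A.rep_self.map φ).map ψ)
        (fun _ _ _ _ _ _ _ => rfl) (fun _ _ _ _ => rfl) }

theorem iso_tensor (φ : Iso A B) (ψ : Iso C D) : Nonempty (Iso (A.tensor C) (B.tensor D)) :=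
  (A.rep_self.tensor C.rep_self).iso ((A.rep_self.map φ).tensor (C.rep_self.map ψ))
    (fun _ _ _ _ _ _ _ => rfl) (fun _ _ _ _ => rfl)

theorem iso_dual (φ : Iso A B) : Nonempty (Iso A.dual B.dual) :=
  A.rep_self.dual.iso (A.rep_self.map φ).dual (fun _ _ _ _ _ _ _ => rfl) (fun _ _ _ _ => rfl)

theorem iso_assoc : Nonempty (Iso ((A.tensor B).tensor C) (A.tensor (B.tensor C))) :=
  ((A.rep_self.tensor B.rep_self).tensor C.rep_self).iso
    (A.rep_self.tensor (B.rep_self.tensor C.rep_self))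
    (fun _ _ _ _ _ _ _ => mul_assoc _ _ _) (fun _ _ _ _ => add_assoc _ _ _)

theorem iso_comm : Nonempty (Iso (A.tensor B) (B.tensor A)) :=
  (A.rep_self.tensor B.rep_self).iso (B.rep_self.tensor A.rep_self)
    (fun _ _ _ _ _ _ _ => mul_comm _ _) (fun _ _ _ _ => add_comm _ _)

theorem iso_trivial : Nonempty (Iso ((trivial V X).tensor A) A) :=
  (rep_trivial.tensor A.rep_self).iso A.rep_self
    (fun _ _ _ _ _ _ _ => one_mul _) (fun _ _ _ _ => zero_add _)

theorem iso_dual_tensor : Nonempty (Iso (A.dual.tensor A) (trivial V X)) := by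
  refine (A.rep_self.dual.tensor A.rep_self).iso rep_trivial
    (fun i j x hi _ hj _ => inv_mul_cancel₀ fun h => ?_) (fun _ _ _ _ => neg_add_cancel _)
  have := trans_smul (L := A.toHolLineBundle) (i := i) hj.2
  rw [h, zero_smul] at this
  exact frame_ne_zero hi.2 this.symm

end ConnLineBundle

open ConnLineBundle

variable (V X) in
/-- The group of isomorphism classes of holomorphic line bundles with holomorphic connection. -/
def PicC : Type (max u v 1) := Quotient (isoSetoid V X)

/-- The class of a line bundle with connection. -/
def PicC.mk (A : ConnLineBundle V X) : PicC V X := Quotient.mk (isoSetoid V X) A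

theorem PicC.mk_eq_mk {A B : ConnLineBundle V X} : PicC.mk A = PicC.mk B ↔ Nonempty (Iso A B) :=
  Quotient.eq (r := isoSetoid V X)

/-- The group law is the tensor product of line bundles with connection. -/
instance : Add (PicC V X) :=
  ⟨Quotient.map₂ ConnLineBundle.tensor fun _ _ ⟨φ⟩ _ _ ⟨ψ⟩ => iso_tensor φ ψ⟩

/-- The neutral element is the class of `(𝒪, d)`. -/
instance : Zero (PicC V X) := ⟨PicC.mk (trivial V X)⟩

/-- The inverse is the dual line bundle with the dual connection. -/
instance : Neg (PicC V X) := ⟨Quotient.map ConnLineBundle.dual fun _ _ ⟨φ⟩ => iso_dual φ⟩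

theorem PicC.mk_add_mk (A B : ConnLineBundle V X) :
    PicC.mk A + PicC.mk B = PicC.mk (A.tensor B) := rfl

instance : AddCommGroup (PicC V X) where
  add_assoc := by rintro ⟨A⟩ ⟨B⟩ ⟨C⟩; exact PicC.mk_eq_mk.2 iso_assoc
  zero_add := by rintro ⟨A⟩; exact PicC.mk_eq_mk.2 iso_trivial
  add_zero := by
    rintro ⟨A⟩
    exact (PicC.mk_eq_mk.2 iso_comm).trans (PicC.mk_eq_mk.2 iso_trivial)
  add_comm := by rintro ⟨A⟩ ⟨B⟩; exact PicC.mk_eq_mk.2 iso_comm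
  neg_add_cancel := by rintro ⟨A⟩; exact PicC.mk_eq_mk.2 iso_dual_tensor
  nsmul := nsmulRec
  zsmul := zsmulRec

variable (V X) in
/-- Holomorphic line bundles with integrable connection. -/
abbrev IntConnLineBundle : Type (max u v 1) := {A : ConnLineBundle V X // A.Integrable}

variable (V X) in
/-- Two line bundles with integrable connection are equivalent if they are isomorphic. -/
def intIsoSetoid : Setoid (IntConnLineBundle V X) where
  r A B := Nonempty (Iso A.1 B.1)
  iseqv :=
    { refl := fun A => (isoSetoid V X).refl A.1
      symm := fun h => (isoSetoid V X).symm h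
      trans := fun h h' => (isoSetoid V X).trans h h' }

variable (V X) in
/-- The group of isomorphism classes of holomorphic line bundles with integrable holomorphic
connection. -/
def PicCI : Type (max u v 1) := Quotient (intIsoSetoid V X)

namespace PicCI

/-- The class of a line bundle with integrable connection. -/
def mk (A : IntConnLineBundle V X) : PicCI V X := Quotient.mk (intIsoSetoid V X) A

theorem mk_eq_mk {A B : IntConnLineBundle V X} : mk A = mk B ↔ Nonempty (Iso A.1 B.1) :=
  Quotient.eq (r := intIsoSetoid V X)

/-- The group law is the tensor product of line bundles with connection. -/
instance : Add (PicCI V X) :=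
  ⟨Quotient.map₂ (fun A B => ⟨A.1.tensor B.1, A.2.tensor B.2⟩)
    fun _ _ ⟨φ⟩ _ _ ⟨ψ⟩ => iso_tensor φ ψ⟩

/-- The neutral element is the class of `(𝒪, d)`. -/
instance : Zero (PicCI V X) := ⟨mk ⟨trivial V X, integrable_trivial⟩⟩

/-- The inverse is the dual line bundle with the dual connection. -/
instance : Neg (PicCI V X) :=
  ⟨Quotient.map (fun A => ⟨A.1.dual, A.2.dual⟩) fun _ _ ⟨φ⟩ => iso_dual φ⟩

instance : AddCommGroup (PicCI V X) where
  add_assoc := by rintro ⟨A⟩ ⟨B⟩ ⟨C⟩; exact mk_eq_mk.2 iso_assoc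
  zero_add := by rintro ⟨A⟩; exact mk_eq_mk.2 iso_trivial
  add_zero := by
    rintro ⟨A⟩
    exact mk_eq_mk.2 ((isoSetoid V X).trans iso_comm iso_trivial)
  add_comm := by rintro ⟨A⟩ ⟨B⟩; exact mk_eq_mk.2 iso_comm
  neg_add_cancel := by rintro ⟨A⟩; exact mk_eq_mk.2 iso_dual_tensor
  nsmul := nsmulRec
  zsmul := zsmulRec

variable (V X) in
/-- The map sending the class of a line bundle with integrable connection to the class of the
same line bundle with the same connection. -/
def toPicC : PicCI V X →+ PicC V X :=
  AddMonoidHom.mk' (Quotient.lift (fun A => PicC.mk A.1) fun _ _ h => PicC.mk_eq_mk.2 h)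
    (by rintro ⟨A⟩ ⟨B⟩; rfl)

end PicCI

end HolPic

end

noncomputable section

namespace HolPic

open Bundle Set Filter
open scoped Topology

universe u v

variable {V : Type u} [NormedAddCommGroup V] [NormedSpace ℂ V]
  {X : Type v} [TopologicalSpace X] [ChartedSpace V X] [IsManifold 𝓘(ℂ, V) ω X]

/-! ### The exterior derivative in arbitrary charts -/

/-! Everything is computed in local frames. If `e` is a local holomorphic frame with `∇ e = α ⊗ e`,
write `s = f e`, `t = k e` and `∇ s = η ⊗ t`; then `f α + df = k η`. Differentiating this relation
and using `d(df) = 0` gives `∇²(∇ s) = dα ⊗ s`, whatever decomposition `η ⊗ t` was chosen. This is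
`nablaTwo_eq`. A curvature must therefore equal `dα` on the domain of every frame. Uniqueness
follows because frames vanish nowhere, and the forms `dα` of two frames agree where both are defined
because both compute the same `∇²(∇ e)`. So the `dα` glue to a global form (`curvature_eq`,
`isCurvature_iff`).

The glued form is holomorphic because `d` preserves holomorphy. Since `extD` at a point is computed
in the preferred chart of that same point, and this chart jumps with the point, it must first be
shown that `d` may be computed in one fixed chart (`chartForm_extD`). This is the compatibility of
`d` with pull-back along changes of charts.

The algebra is read off from connection forms through `Rep`: an isomorphism carries frames to frames
with the same forms (`curvature_congr`), and a tensor product adds the forms (`curvature_tensor`).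
Hence the curvature is a homomorphism on isomorphism classes. Its kernel consists of the classes
with `∇² ∘ ∇ = 0`, which are the integrable ones. Injectivity on the left holds because isomorphisms
of integrable bundles are the same as isomorphisms of the underlying bundles with connection. -/

theorem mdifferentiableAt_extChartAt_symm {x : X} {z : V}
    (hz : z ∈ (extChartAt 𝓘(ℂ, V) x).target) :
    MDifferentiableAt 𝓘(ℂ, V) 𝓘(ℂ, V) (extChartAt 𝓘(ℂ, V) x).symm z := by
  have := mdifferentiableWithinAt_extChartAt_symm (I := 𝓘(ℂ, V)) hz
  rwa [modelWithCornersSelf_coe, range_id, mdifferentiableWithinAt_univ] at this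

/-- The expressions of a form in two charts are related by pull-back along the change of charts. -/
theorem chartForm_eq_pullback {p : ℕ} (η : Form V X p) (x y : X) {z : V}
    (hz : z ∈ (extChartAt 𝓘(ℂ, V) x).target)
    (hy : (extChartAt 𝓘(ℂ, V) x).symm z ∈ (extChartAt 𝓘(ℂ, V) y).source) :
    chartForm η x z =
      (chartForm η y (extChartAt 𝓘(ℂ, V) y ((extChartAt 𝓘(ℂ, V) x).symm z))).compContinuousLinearMap
        (fderiv ℂ (extChartAt 𝓘(ℂ, V) y ∘ (extChartAt 𝓘(ℂ, V) x).symm) z) := by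
  set φ := extChartAt 𝓘(ℂ, V) y
  set ψ := extChartAt 𝓘(ℂ, V) x
  have hψ := mdifferentiableAt_extChartAt_symm hz
  have hφ : MDifferentiableAt 𝓘(ℂ, V) 𝓘(ℂ, V) φ (ψ.symm z) :=
    mdifferentiableAt_extChartAt (by rwa [← extChartAt_source 𝓘(ℂ, V)])
  have hφ' : MDifferentiableAt 𝓘(ℂ, V) 𝓘(ℂ, V) φ.symm ((φ ∘ ψ.symm) z) :=
    mdifferentiableAt_extChartAt_symm (φ.map_source hy)
  -- The chain rule for this identity, valid only near `z`, factors the derivative of `ψ.symm`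
  -- through the change of charts.
  have hev : φ.symm ∘ (φ ∘ ψ.symm) =ᶠ[𝓝 z] ψ.symm := by
    filter_upwards [hψ.continuousAt.preimage_mem_nhds ((isOpen_extChartAt_source y).mem_nhds hy)]
      with z' hz' using φ.left_inv hz'
  have hcomp : (mfderiv 𝓘(ℂ, V) 𝓘(ℂ, V) ψ.symm z : V →L[ℂ] V) =
      (mfderiv 𝓘(ℂ, V) 𝓘(ℂ, V) φ.symm ((φ ∘ ψ.symm) z) : V →L[ℂ] V).comp
        (fderiv ℂ (φ ∘ ψ.symm) z) := by
    have h := mfderiv_comp z hφ' (hφ.comp z hψ)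
    rw [mfderiv_eq_fderiv (f := φ ∘ ψ.symm), hev.mfderiv_eq] at h
    exact h
  -- The two base points are equal but not definitionally so. The values of `η` become comparable
  -- once both tangent spaces are read as the model space `V`.
  have hpt : (η (φ.symm (φ (ψ.symm z))) : V [⋀^Fin p]→L[ℂ] ℂ) = η (ψ.symm z) := by
    have h : ∀ a b : X, a = b → (η a : V [⋀^Fin p]→L[ℂ] ℂ) = η b := by rintro _ _ rfl; rfl
    exact h _ _ (φ.left_inv hy)
  -- With every tangent space unfolded to `V`, both sides are pull-backs of forms on `V`, and
  -- functoriality of the pull-back closes the goal.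
  change ContinuousAlternatingMap.compContinuousLinearMap
      (η (ψ.symm z) : V [⋀^Fin p]→L[ℂ] ℂ) (mfderiv 𝓘(ℂ, V) 𝓘(ℂ, V) ψ.symm z : V →L[ℂ] V) =
    (ContinuousAlternatingMap.compContinuousLinearMap
      (η (φ.symm (φ (ψ.symm z))) : V [⋀^Fin p]→L[ℂ] ℂ)
      (mfderiv 𝓘(ℂ, V) 𝓘(ℂ, V) φ.symm ((φ ∘ ψ.symm) z) : V →L[ℂ] V)).compContinuousLinearMap
        (fderiv ℂ (φ ∘ ψ.symm) z)
  rw [hcomp, hpt]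
  rfl

/-- The exterior derivative may be computed in every chart. -/
theorem chartForm_extD {p : ℕ} {η : Form V X p} {x : X} {z : V}
    (hz : z ∈ (extChartAt 𝓘(ℂ, V) x).target)
    (hη : HolFormAt η ((extChartAt 𝓘(ℂ, V) x).symm z)) :
    chartForm (extD η) x z = extDeriv (chartForm η x) z := by
  set ψ := extChartAt 𝓘(ℂ, V) x
  -- This is the chart in which `extD η` is defined at the point `ψ.symm z`; it is in general not
  -- the chart `ψ` at `x`.
  set φ := extChartAt 𝓘(ℂ, V) (ψ.symm z)
  have hψ := mdifferentiableAt_extChartAt_symm hz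
  have hy : ψ.symm z ∈ φ.source := mem_extChartAt_source _
  have hφ : MDifferentiableAt 𝓘(ℂ, V) 𝓘(ℂ, V) φ (ψ.symm z) :=
    mdifferentiableAt_extChartAt (mem_chart_source V _)
  -- The chart `φ` stays fixed while `z'` varies: the exterior derivative at `z` depends on the
  -- germ, so equality at `z` alone would not be enough.
  have hev : chartForm η x =ᶠ[𝓝 z] fun z' =>
      (chartForm η (ψ.symm z) ((φ ∘ ψ.symm) z')).compContinuousLinearMap
        (fderiv ℂ (φ ∘ ψ.symm) z') := by
    filter_upwards [(isOpen_extChartAt_target x).mem_nhds hz,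
      hψ.continuousAt.preimage_mem_nhds ((isOpen_extChartAt_source _).mem_nhds hy)]
      with z' h1 h2 using chartForm_eq_pullback η x _ h1 h2
  have hτ : ContDiffAt ℂ ω (φ ∘ ψ.symm) z := by
    rw [← contMDiffAt_iff_contDiffAt]
    have h := (contMDiffOn_extChartAt_symm (I := 𝓘(ℂ, V)) (n := ω) x).contMDiffAt
      ((isOpen_extChartAt_target x).mem_nhds hz)
    exact (contMDiffAt_extChartAt (I := 𝓘(ℂ, V)) (n := ω) (x := ψ.symm z)).comp z h
  have hcomp : (mfderiv 𝓘(ℂ, V) 𝓘(ℂ, V) φ (ψ.symm z) : V →L[ℂ] V).comp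
      (mfderiv 𝓘(ℂ, V) 𝓘(ℂ, V) ψ.symm z : V →L[ℂ] V) = fderiv ℂ (φ ∘ ψ.symm) z := by
    have h := mfderiv_comp z hφ hψ
    rw [mfderiv_eq_fderiv] at h
    exact h.symm
  -- `d` commutes with pull-back along `φ ∘ ψ.symm`. Splitting the derivative of this map by `hcomp`
  -- leaves the definitions of `extD` and `chartForm` on the two sides.
  rw [hev.extDeriv_eq, extDeriv_pullback (r := ω) (f := φ ∘ ψ.symm) (ContDiffAt.differentiableAt hη (by simp)) hτ
    (by simp), ← hcomp]
  rfl

/-! ### Holomorphy of the exterior derivative -/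

-- The exterior derivative is a fixed continuous linear map, the alternatization, applied to the
-- derivative. Differentiation costs no regularity at order `ω`, since `ω + 1 = ω`.
set_option synthInstance.maxHeartbeats 200000 in
theorem _root_.ContDiffAt.extDeriv {p : ℕ} {θ : V → V [⋀^Fin p]→L[ℂ] ℂ} {z : V}
    (h : ContDiffAt ℂ ω θ z) : ContDiffAt ℂ ω (extDeriv θ) z := by
  have h' : ContDiffAt ℂ ω (fderiv ℂ θ) z := h.fderiv_right (by simp)
  exact h'.continuousLinearMap_comp
    (ContinuousAlternatingMap.alternatizeUncurryFinCLM (n := p) ℂ V ℂ)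

/-- The exterior derivative of a form which is holomorphic in a neighbourhood is holomorphic. -/
theorem HolFormAt.extD {p : ℕ} {η : Form V X p} {x : X} (h : ∀ᶠ y in 𝓝 x, HolFormAt η y) :
    HolFormAt (extD η) x := by
  refine (ContDiffAt.extDeriv h.self_of_nhds).congr_of_eventuallyEq ?_
  have h' := (continuousAt_extChartAt_symm (I := 𝓘(ℂ, V)) x).eventually
    (p := HolFormAt η) (by rwa [extChartAt_to_inv])
  filter_upwards [h', (isOpen_extChartAt_target x).mem_nhds (mem_extChartAt_target x)]
    with z h1 h2 using chartForm_extD h2 h1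

/-- Holomorphy at `x` sees only the germ of the form, because the inverse chart is continuous. It
serves to replace a form defined pointwise by a local expression of it. -/
theorem HolFormAt.congr {p : ℕ} {η θ : Form V X p} {x : X} (h : HolFormAt η x)
    (e : ∀ᶠ y in 𝓝 x, θ y = η y) : HolFormAt θ x := by
  refine ContDiffAt.congr_of_eventuallyEq h ?_
  have h' := (continuousAt_extChartAt_symm (I := 𝓘(ℂ, V)) x).eventually
    (p := fun y => θ y = η y) (by rwa [extChartAt_to_inv])
  filter_upwards [h'] with z hz
  rw [chartForm, chartForm, hz]

/-- Curvature computations such as `nablaTwo_eq` are stated on pairs `![v, w]`; this turns them into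
equalities of forms. -/
theorem form_two_ext {x : X} {a b : TangentSpace 𝓘(ℂ, V) x [⋀^Fin 2]→L[ℂ] ℂ}
    (h : ∀ v w, a ![v, w] = b ![v, w]) : a = b := by
  refine ContinuousAlternatingMap.ext fun m => ?_
  have hm : m = ![m 0, m 1] := by
    ext i; fin_cases i <;> rfl
  rw [hm]
  exact h _ _

/-! ### The curvature -/

namespace ConnLineBundle

open HolLineBundle

variable {A B : ConnLineBundle V X}

/-- The curvature is the exterior derivative of the connection forms of any system of local
frames. -/
theorem Rep.isCurvature_iff {U : X → Set X} {g : X → X → X → ℂ}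
    {α : X → ∀ x : X, TangentSpace 𝓘(ℂ, V) x →L[ℂ] ℂ} (hA : A.Rep U g α) {R : Form V X 2} :
    A.IsCurvature R ↔ ∀ i, ∀ x ∈ U i, R x = extD (oneForm (α i)) x := by
  obtain ⟨e, he⟩ := hA.ex
  have hc : ∀ i x, x ∈ U i → ∀ᶠ y in 𝓝 x, A.conn (e i) y = (α i y).smulRight (e i y) := by
    intro i x hx
    filter_upwards [(hA.isOpen i).mem_nhds hx] with y hy using (he i y hy).2.2.1
  constructor
  · intro h i x hx
    obtain ⟨h1, h2, -, -⟩ := he i x hx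
    refine form_two_ext fun v w => ?_
    -- Testing on the frame itself, with the tautological decomposition `∇ e = α ⊗ e`, is enough to
    -- determine `R`, because `e i x` is nonzero.
    have h3 := h x (e i) (e i) (α i) h1 h1 (hA.hol hx) (hc i x hx) v w
    rw [nablaTwo_eq h1 h2 (hA.hol hx) (hc i x hx) h1 h1 (hA.hol hx) (hc i x hx)] at h3
    exact (smul_left_injective ℂ h2 h3).symm
  · intro h x s t η hs ht hη hst v w
    obtain ⟨h1, h2, -, -⟩ := he x x (hA.mem x)
    rw [nablaTwo_eq h1 h2 (hA.hol (hA.mem x)) (hc x x (hA.mem x)) hs ht hη hst,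
      h x x (hA.mem x)]

/-- The curvature form of a line bundle with connection. -/
def curvature (A : ConnLineBundle V X) : Form V X 2 := fun x => extD (oneForm (A.connForm x)) x

/-- The curvature form is locally the exterior derivative of the connection form of the frame given
by any preferred trivialization. -/
theorem curvature_eq {i x : X} (hx : x ∈ A.dom i) :
    A.curvature x = extD (oneForm (A.connForm i)) x := by
  refine form_two_ext fun v w => ?_
  have hc : ∀ j, x ∈ A.dom j → ∀ᶠ y in 𝓝 x,
      A.conn (A.frame j) y = (A.connForm j y).smulRight (A.frame j y) := by
    intro j hj
    filter_upwards [A.dom_mem_nhds hj] with y hy using conn_frame hy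
  -- The left side does not involve `j`: the same `∇²(∇ e)`, for the frame at `i`, is computed with
  -- the reference frame at `j`. Comparing `j = x` with `j = i` gives the independence of the frame,
  -- with no recourse to transition functions.
  have key : ∀ j, x ∈ A.dom j → A.nablaTwo (A.connForm i) (A.frame i) x v w =
      extD (oneForm (A.connForm j)) x ![v, w] • A.frame i x := fun j hj =>
    nablaTwo_eq (holAt_frame hj) (frame_ne_zero hj) (hol_connForm hj) (hc j hj)
      (holAt_frame hx) (holAt_frame hx) (hol_connForm hx) (hc i hx) v w
  exact smul_left_injective ℂ (frame_ne_zero hx) ((key x (A.mem_dom x)).symm.trans (key i hx))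

/-- By definition `curvature` uses a different frame at every point, so its regularity is not
visible there. By `curvature_eq` the frame at `x` can be used throughout a neighbourhood of `x`, and
there the form is `d` of one holomorphic form. -/
theorem holFormAt_curvature (A : ConnLineBundle V X) (x : X) : HolFormAt A.curvature x := by
  have hd := A.dom_mem_nhds (A.mem_dom x)
  refine (HolFormAt.extD (η := oneForm (A.connForm x)) ?_).congr ?_
  · filter_upwards [hd] with y hy using hol_connForm hy
  · filter_upwards [hd] with y hy using curvature_eq hy

/-- Existence and uniqueness of the curvature in one equivalence; no holomorphy of `R` has to be
assumed. -/
theorem isCurvature_iff {R : Form V X 2} : A.IsCurvature R ↔ A.curvature = R := by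
  rw [A.rep_self.isCurvature_iff]
  refine ⟨fun h => funext fun x => (h x x (A.mem_dom x)).symm, ?_⟩
  rintro rfl i x hx
  exact curvature_eq hx

theorem isCurvature_curvature (A : ConnLineBundle V X) : A.IsCurvature A.curvature :=
  isCurvature_iff.2 rfl

theorem curvature_congr (φ : Iso A B) : A.curvature = B.curvature := by
  refine (isCurvature_iff.1 ?_).symm
  -- The frames of `A` transported by `φ` are frames of `B` with the same connection forms, so both
  -- bundles impose the same local condition on a curvature.
  rw [(A.rep_self.map φ).isCurvature_iff, ← A.rep_self.isCurvature_iff]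
  exact A.isCurvature_curvature

/-- The products of the frames have as connection forms the sums of the connection forms, and `d` is
additive. -/
theorem curvature_tensor (A B : ConnLineBundle V X) :
    (A.tensor B).curvature = A.curvature + B.curvature := by
  have hAB := A.rep_self.tensor B.rep_self
  refine isCurvature_iff.1 (hAB.isCurvature_iff.2 fun i x hx => form_two_ext fun v w => ?_)
  rw [extD_oneForm_add (A.rep_self.hol hx.1) (B.rep_self.hol hx.2) (hAB.hol hx),
    Pi.add_apply, curvature_eq hx.1, curvature_eq hx.2]
  rfl

theorem integrable_iff_isCurvature_zero : A.Integrable ↔ A.IsCurvature 0 := by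
  have h : ∀ (x : X) (v w : TangentSpace 𝓘(ℂ, V) x) (s : A.fiber x),
      (0 : Form V X 2) x ![v, w] • s = 0 := fun _ _ _ s => zero_smul ℂ s
  simp only [Integrable, IsCurvature, h]

end ConnLineBundle

/-! ### The curvature homomorphism and the exact sequence -/

open ConnLineBundle

/-- The homomorphism that sends the class of a line bundle with connection to the curvature. -/
def PicC.curvature : PicC V X →+ HolForm V X 2 :=
  AddMonoidHom.mk'
    (Quotient.lift (fun A => ⟨A.curvature, A.holFormAt_curvature⟩)
      fun _ _ ⟨φ⟩ => Subtype.ext (curvature_congr φ))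
    (by rintro ⟨A⟩ ⟨B⟩; exact Subtype.ext (curvature_tensor A B))

theorem PicC.curvature_mk_eq_iff {A : ConnLineBundle V X} {R : HolForm V X 2} :
    PicC.curvature (PicC.mk A) = R ↔ A.IsCurvature R :=
  Subtype.ext_iff.trans isCurvature_iff.symm

/-- Both quotients are taken by the same relation: an isomorphism of integrable bundles carries no
condition beyond compatibility with the connections. -/
theorem PicCI.toPicC_injective : Function.Injective (PicCI.toPicC V X) := by
  rintro ⟨A⟩ ⟨B⟩ h
  exact PicCI.mk_eq_mk.2 (PicC.mk_eq_mk.1 h)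

theorem PicCI.exact_toPicC_curvature :
    Function.Exact (PicCI.toPicC V X) (PicC.curvature (V := V) (X := X)) := by
  rintro ⟨A⟩
  refine (PicC.curvature_mk_eq_iff (A := A) (R := 0)).trans
    (integrable_iff_isCurvature_zero.symm.trans ⟨fun h => ⟨PicCI.mk ⟨A, h⟩, rfl⟩, ?_⟩)
  -- A class in the image is represented by an integrable `B`, but the chosen representative `A` is
  -- only isomorphic to it. Integrability passes from `B` to `A` because it means zero curvature,
  -- which is invariant under isomorphism.
  rintro ⟨⟨B⟩, h⟩
  obtain ⟨φ⟩ := PicC.mk_eq_mk.1 h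
  rw [integrable_iff_isCurvature_zero, isCurvature_iff, ← curvature_congr φ, ← isCurvature_iff,
    ← integrable_iff_isCurvature_zero]
  exact B.2

end HolPic

end

/-- In the first clause, taking `R` to be `κ (HolPic.PicC.mk A)` shows that a holomorphic curvature
exists, and the implication from right to left shows that it is the only one. -/
theorem mainTheorem10 (V : Type*) [NormedAddCommGroup V] [NormedSpace ℂ V]
    [FiniteDimensional ℂ V] (X : Type*) [TopologicalSpace X] [ChartedSpace V X]
    [IsManifold 𝓘(ℂ, V) ω X] :
    ∃ κ : HolPic.PicC V X →+ HolPic.HolForm V X 2,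
      (∀ (A : HolPic.ConnLineBundle V X) (R : HolPic.HolForm V X 2),
        κ (HolPic.PicC.mk A) = R ↔ A.IsCurvature R) ∧
      Function.Injective (HolPic.PicCI.toPicC V X) ∧
      Function.Exact (HolPic.PicCI.toPicC V X) κ :=
  ⟨HolPic.PicC.curvature, fun _ _ => HolPic.PicC.curvature_mk_eq_iff,
    HolPic.PicCI.toPicC_injective, HolPic.PicCI.exact_toPicC_curvature⟩
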